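/- Let $N$ be a prime, put $x_j=1+2N(j-1)+\{(j-1)^2 \bmod N\}$ for $j=1,\dots,N$ (the Erdős–Turán Golomb ruler; $\{m \bmod N\}\in\{0,\dots,N-1\}$), and let $L$ be a prime with $L\ge 2x_N-1$. Consider $N$ spinless fermions on the chain $\{1,\dots,L\}$ with Hamiltonian $$\hat H=\sum_{x=1}^{L}\bigl(e^{i\theta}\hat c^\dagger_x\hat c_{x+1}+e^{-i\theta}\hat c^\dagger_{x+1}\hat c_x\bigr),\qquad \hat c_{L+1}=\hat c_1,$$ where $\hat c_x,\hat c_x^\dagger$ are the fermionic annihilation and creation operators on Fock space, and where $\theta\in\mathbb R$ is such that the $N$-particle energies are nondegenerate: the numbers $E_{\kappa}=2\sum_{\nu\in\kappa}\cos(2\pi\nu/L+\theta)$, for $\kappa$ ranging over the $N$-element subsets of $\{0,\pm1,\dots,\pm\frac{L-1}{2}\}$, are pairwise distinct. Let $\mathcal H_{\rm tot}$ be the $N$-particle Hilbert space, $D_{\rm tot}=\dim\mathcal H_{\rm tot}$, and take the initial state $|\Phi(0)\rangle=\hat c^\dagger_{x_1}\cdots\hat c^\dagger_{x_N}|{\rm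 vac}\rangle$, evolving as $|\Phi(t)\rangle=e^{-i\hat Ht}|\Phi(0)\rangle$. Then: (1) For every orthonormal basis $(\Psi_j)_{j=1}^{D_{\rm tot}}$ of $\mathcal H_{\rm tot}$ consisting of eigenvectors of $\hat H$, the effective dimension $D_{\rm eff}=\bigl(\sum_j|\langle\Phi(0)|\Psi_j\rangle|^4\bigr)^{-1}$ satisfies $$\frac{D_{\rm tot}}{D_{\rm eff}}\le\frac{N+2e-3}{e}.$$ (2) For every $\varepsilon>0$ there is $N_0$, depending only on $\varepsilon$, such that whenever $N\ge N_0$ (with $N$, $L$, $\theta$ as above) there exist $T>0$ and a finite union of intervals $G\subset[0,T]$, of total length $\mu(G)$, with $$\frac{\mu(G)}{T}\ge 1-e^{-(\varepsilon^2/4)N},$$ such that, for every $t\in G$, a measurement of $\hat N_{\rm left}=\sum_{x=1}^{(L+1)/2}\hat c_x^\dagger\hat c_x$ in the state $|\Phi(t)\rangle$ gives, with probability larger than $1-e^{-(\varepsilon^2/4)N}$, a result $N_{\rm left}$ with $$\Bigl|\frac{N_{\rm left}}{N}-\frac12\Bigr|\le\varepsilon .$$ -/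

import Mathlib

noncomputable section

namespace GolombChain

/-- Fermionic Fock space of the chain with `L` sites, with orthonormal occupation basis `|S⟩`,
`S` being the set of occupied sites.  The site `x ∈ {1, …, L}` is the element of `Fin L` with
value `x - 1`. -/
abbrev Fock (L : ℕ) : Type := EuclideanSpace ℂ (Finset (Fin L))

/-- The state `|Φ_vac⟩` with no particles. -/
def vacuum (L : ℕ) : Fock L := EuclideanSpace.single ∅ 1

/-- The Jordan–Wigner sign `(-1)^{#{y ∈ S : y < x}}`. -/
def jwSign {L : ℕ} (x : Fin L) (S : Finset (Fin L)) : ℂ :=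
  (-1) ^ (S.filter (fun y => y < x)).card

/-- The creation operator `c†_x`: `c†_x |S⟩ = (-1)^{#{y ∈ S : y < x}} |S ∪ {x}⟩` if `x ∉ S`,
and `c†_x |S⟩ = 0` if `x ∈ S`. -/
def creation {L : ℕ} (x : Fin L) : Fock L →L[ℂ] Fock L :=
  LinearMap.toContinuousLinearMap
    { toFun := fun ψ => WithLp.toLp 2 fun S =>
        if x ∈ S then jwSign x S * ψ (S.erase x) else 0
      map_add' := by
        intro ψ φ
        ext S
        by_cases h : x ∈ S <;> simp [h, mul_add]
      map_smul' := by
        intro a ψ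
        ext S
        by_cases h : x ∈ S <;> simp [h, mul_left_comm] }

/-- The annihilation operator `c_x`, the adjoint of `c†_x`. -/
def annihilation {L : ℕ} (x : Fin L) : Fock L →L[ℂ] Fock L :=
  ContinuousLinearMap.adjoint (creation x)

/-- The occupation number operator `n_x = c†_x c_x`. -/
def numberAt {L : ℕ} (x : Fin L) : Fock L →L[ℂ] Fock L :=
  creation x * annihilation x

/-- The Hilbert space `H_tot` of states with exactly `N` particles. -/
def sector (L N : ℕ) : Submodule ℂ (Fock L) where
  carrier := {ψ | ∀ S : Finset (Fin L), S.card ≠ N → ψ S = 0}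
  add_mem' := by
    intro ψ φ hψ hφ S hS
    simp [hψ S hS, hφ S hS]
  zero_mem' := by
    intro S _
    simp
  smul_mem' := by
    intro a ψ hψ S hS
    simp [hψ S hS]

/-- The Hamiltonian `H = ∑_x (e^{iθ} c†_x c_{x+1} + e^{-iθ} c†_{x+1} c_x)` with periodic boundary
condition; `finRotate L` is the cyclic shift `x ↦ x + 1`. -/
def hamiltonian (L : ℕ) (θ : ℝ) : Fock L →L[ℂ] Fock L :=
  ∑ x : Fin L,
    (Complex.exp (Complex.I * θ) • (creation x * annihilation (finRotate L x)) +
      Complex.exp (-(Complex.I * θ)) • (creation (finRotate L x) * annihilation x))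

/-- The indices `ν = 0, ±1, …, ±(L-1)/2` of the momenta `k = 2πν/L` (for odd `L`). -/
def momentumIndices (L : ℕ) : Finset ℤ :=
  Finset.Icc (-(((L : ℤ) - 1) / 2)) (((L : ℤ) - 1) / 2)

/-- The energy `E_k = 2 ∑_j cos (k_j + θ)` of the set of momenta `k_j = 2πν/L`, `ν ∈ κ`. -/
def energy (L : ℕ) (θ : ℝ) (κ : Finset ℤ) : ℝ :=
  2 * ∑ ν ∈ κ, Real.cos (2 * Real.pi / L * ν + θ)

/-- The `N`-particle energies `E_k` are nondegenerate: distinct sets of `N` momenta have distinct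
energies. -/
def Nondegenerate (L N : ℕ) (θ : ℝ) : Prop :=
  ∀ κ ∈ (momentumIndices L).powersetCard N, ∀ κ' ∈ (momentumIndices L).powersetCard N,
    energy L θ κ = energy L θ κ' → κ = κ'

/-- The family `Ψ_j` consists of eigenvectors of the Hamiltonian. -/
def IsEnergyEigenbasis {L N : ℕ} (θ : ℝ)
    (Ψ : OrthonormalBasis (Fin (Module.finrank ℂ (sector L N))) ℂ (sector L N)) : Prop :=
  ∀ j, ∃ E : ℝ, hamiltonian L θ (Ψ j : Fock L) = (E : ℂ) • (Ψ j : Fock L)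

/-- The effective dimension `D_eff = (∑_j |⟨Φ, Ψ_j⟩|⁴)⁻¹`. -/
def effectiveDimension {L N : ℕ}
    (Ψ : OrthonormalBasis (Fin (Module.finrank ℂ (sector L N))) ℂ (sector L N))
    (Φ : Fock L) : ℝ :=
  (∑ j, ‖inner ℂ Φ (Ψ j : Fock L)‖ ^ 4)⁻¹

/-- The Erdős–Turán positions `x_j = 1 + 2N(j-1) + ((j-1)² mod N)`, for `j = 1, …, N`. -/
def erdosTuran (N j : ℕ) : ℕ := 1 + 2 * N * (j - 1) + (j - 1) ^ 2 % N

/-- The site `x ∈ {1, …, L}` as an element of `Fin L`. -/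
def site (L : ℕ) [NeZero L] (x : ℕ) : Fin L := Fin.ofNat L (x - 1)

/-- The initial state `c†_{x_1} c†_{x_2} ⋯ c†_{x_N} |Φ_vac⟩` with the Erdős–Turán positions. -/
def initialState (L N : ℕ) [NeZero L] : Fock L :=
  (List.ofFn fun j : Fin N => creation (site L (erdosTuran N (j + 1)))).prod (vacuum L)

/-- The time-evolved state `Φ(t) = e^{-iHt} Φ`. -/
def evolve (L : ℕ) (θ : ℝ) (t : ℝ) (Φ : Fock L) : Fock L :=
  NormedSpace.exp ((-(Complex.I * t)) • hamiltonian L θ) Φ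

/-- The particle number `N_left = ∑_{x = 1}^{(L+1)/2} n_x` in the left half of the chain. -/
def numberLeft (L : ℕ) : Fock L →L[ℂ] Fock L :=
  ∑ x : Fin L with x.val + 1 ≤ (L + 1) / 2, numberAt x

/-- Born rule: the probability that a measurement of the self-adjoint operator `A` in the normalized
state `Φ` gives an outcome in `B`, i.e. `⟨Φ, P Φ⟩ = ‖P Φ‖²` with `P` the orthogonal projection onto
the span of the eigenspaces of `A` with eigenvalue in `B`. -/
def measurementProb {L : ℕ} (A : Fock L →L[ℂ] Fock L) (Φ : Fock L) (B : Set ℝ) : ℝ :=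
  ‖(⨆ a ∈ B, Module.End.eigenspace (A : Fock L →ₗ[ℂ] Fock L) (a : ℂ)).starProjection Φ‖ ^ 2

/-- `G` is a finite union of intervals of the real line. -/
def IsUnionOfIntervals (G : Set ℝ) : Prop :=
  ∃ F : Set (Set ℝ), F.Finite ∧ (∀ I ∈ F, I.OrdConnected) ∧ G = ⋃₀ F

end GolombChain

end

namespace GolombChain

/-! Creating particles in plane-wave modes gives Slater determinants, which are eigenvectors of the
Hamiltonian with energies `E_κ`. Nondegeneracy makes them orthogonal, hence a basis of the sector,
and any other eigenbasis agrees with it up to phases and order. The overlap of the initial state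
with such a vector is, up to phase, a determinant of plane waves evaluated at the sites `x_j`.

For (1), write |det|⁴ = det² · conj(det²) and expand over permutations σ, σ', τ, τ'. The sum over
ordered momenta factorises into character sums, which vanish unless x_{σ i} + x_{σ' i} ≡ x_{τ i} +
x_{τ' i} mod L for every i. The ruler is a Sidon set modulo L (`erdosTuranPos_sidon`), so only
quadruples with {σ i, σ' i} = {τ i, τ' i} for all i survive, each of size L^{-N}. They inject into
triples of one permutation and a pair with disjoint supports, so there are at most N!² ∑_{m ≤ N} d_m
/ m! of them (`card_matching_perm_quadruples_le`). Dividing by the N! orderings and using `L.choose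
N` ≤ L^N / N! gives D_tot / D_eff ≤ ∑ d_m / m!, where d_m / m! is close to 1/e.

For (2), since the energies are distinct, the cross terms in the weight of the unbalanced
configurations average out over time. Cauchy–Schwarz bounds the square of the average by #unbalanced
/ D_eff (`averageWeight_sq_le`). A Chernoff bound makes the unbalanced fraction of configurations of
order e^{-2ε²N}, while (1) costs only a factor linear in N. Markov's inequality in time then
produces the set of good times. -/

/-! ### Arithmetic of the Erdős–Turán ruler -/

/-- Substituting b = c + d - a gives a² + b² - c² - d² = 2(a - c)(a - d). For odd N the prime
divides a - c or a - d, which are smaller than N in absolute value. For N = 2 the sum alone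
determines the pair. -/
theorem pair_eq_of_add_eq_of_sq_add_modEq {N : ℕ} (hN : N.Prime) {a b c d : ℕ}
    (ha : a < N) (hb : b < N) (hc : c < N) (hd : d < N) (hadd : a + b = c + d)
    (hsq : a ^ 2 + b ^ 2 ≡ c ^ 2 + d ^ 2 [MOD N]) :
    (a = c ∧ b = d) ∨ (a = d ∧ b = c) := by
  rcases hN.eq_two_or_odd' with rfl | hodd
  · omega
  have h1 : (N : ℤ) ∣ 2 * ((a - c) * (a - d)) := by
    have h := (Nat.modEq_iff_dvd.mp hsq)
    push_cast at h
    have hb' : (b : ℤ) = c + d - a := by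
      have : (a : ℤ) + b = c + d := by exact_mod_cast hadd
      linarith
    rw [hb'] at h
    have e : 2 * (((a : ℤ) - c) * (a - d))
        = -((c : ℤ) ^ 2 + d ^ 2 - (a ^ 2 + (c + d - a) ^ 2)) := by ring
    rw [e]
    exact dvd_neg.mpr h
  have hNi : Prime (N : ℤ) := Nat.prime_iff_prime_int.mp hN
  rcases hNi.dvd_or_dvd h1 with h | h
  · have : N ∣ 2 := by exact_mod_cast h
    have := (Nat.prime_dvd_prime_iff_eq hN Nat.prime_two).mp this
    subst this
    exact absurd hodd (by decide)
  · rcases hNi.dvd_or_dvd h with h | h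
    · have : (a : ℤ) - c = 0 := Int.eq_zero_of_abs_lt_dvd h (by rw [abs_lt]; omega)
      omega
    · have : (a : ℤ) - d = 0 := Int.eq_zero_of_abs_lt_dvd h (by rw [abs_lt]; omega)
      omega

/-- The Erdős–Turán positions, counted from zero. -/
def erdosTuranPos (N j : ℕ) : ℕ := 2 * N * j + j ^ 2 % N

theorem erdosTuran_succ (N j : ℕ) : erdosTuran N (j + 1) = erdosTuranPos N j + 1 := by
  simp [erdosTuran, erdosTuranPos]; ring

theorem erdosTuranPos_strictMono {N : ℕ} (hN : 0 < N) : StrictMono (erdosTuranPos N) := by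
  refine strictMono_nat_of_lt_succ fun n => ?_
  have h1 := Nat.mod_lt (n ^ 2) hN
  have h2 : 2 * N * (n + 1) = 2 * N * n + 2 * N := by ring
  simp only [erdosTuranPos]
  omega

theorem two_mul_erdosTuranPos_lt {N L : ℕ} (hN : N.Prime) (hL : 2 * erdosTuran N N - 1 ≤ L)
    {j : ℕ} (hj : j < N) : 2 * erdosTuranPos N j < L := by
  obtain ⟨M, rfl⟩ : ∃ M, N = M + 1 := ⟨N - 1, by have := hN.pos; omega⟩
  rw [erdosTuran_succ] at hL
  have := (erdosTuranPos_strictMono hN.pos).monotone (Nat.lt_succ_iff.mp hj)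
  omega

/-- All positions lie below L/2, so the congruence is an equality. The sums of two residues are
below 2N, so the quotient by 2N recovers a + b and the remainder recovers a² + b² modulo N. -/
theorem erdosTuranPos_sidon {N L : ℕ} (hN : N.Prime) (hL : 2 * erdosTuran N N - 1 ≤ L)
    {a b c d : ℕ} (ha : a < N) (hb : b < N) (hc : c < N) (hd : d < N)
    (h : (L : ℤ) ∣ erdosTuranPos N a + erdosTuranPos N b
      - erdosTuranPos N c - erdosTuranPos N d) :
    (a = c ∧ b = d) ∨ (a = d ∧ b = c) := by
  have h1 := two_mul_erdosTuranPos_lt hN hL ha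
  have h2 := two_mul_erdosTuranPos_lt hN hL hb
  have h3 := two_mul_erdosTuranPos_lt hN hL hc
  have h4 := two_mul_erdosTuranPos_lt hN hL hd
  have h5 := Int.eq_zero_of_abs_lt_dvd h (by rw [abs_lt]; omega)
  have h6 : erdosTuranPos N a + erdosTuranPos N b = erdosTuranPos N c + erdosTuranPos N d := by
    omega
  have r1 := Nat.mod_lt (a ^ 2) hN.pos
  have r2 := Nat.mod_lt (b ^ 2) hN.pos
  have r3 := Nat.mod_lt (c ^ 2) hN.pos
  have r4 := Nat.mod_lt (d ^ 2) hN.pos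
  simp only [erdosTuranPos] at h6
  have h7 : 2 * N * (a + b) + (a ^ 2 % N + b ^ 2 % N)
      = 2 * N * (c + d) + (c ^ 2 % N + d ^ 2 % N) := by linarith
  have hadd : a + b = c + d := by
    have e1 := congrArg (· / (2 * N)) h7
    rwa [Nat.mul_add_div (by omega), Nat.mul_add_div (by omega), Nat.div_eq_of_lt (by omega),
      Nat.div_eq_of_lt (by omega), add_zero, add_zero] at e1
  refine pair_eq_of_add_eq_of_sq_add_modEq hN ha hb hc hd hadd ?_
  rw [hadd] at h7
  have h8 := Nat.add_left_cancel h7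
  rw [Nat.ModEq, Nat.add_mod, h8, ← Nat.add_mod]

theorem lower_bound_chain_length {N L : ℕ} (hN : N.Prime) (hL : 2 * erdosTuran N N - 1 ≤ L) :
    4 * N * (N - 1) + 1 ≤ L := by
  obtain ⟨M, rfl⟩ : ∃ M, N = M + 1 := ⟨N - 1, by have := hN.pos; omega⟩
  rw [erdosTuran_succ, erdosTuranPos] at hL
  have : 4 * (M + 1) * (M + 1 - 1) = 2 * (2 * (M + 1) * M) := by simp; ring
  omega

/-! ### Sums of derangement probabilities -/

/-- `∑_{m ≤ N} d_m / m!`, where `d_m` is the number of derangements of `m` objects. -/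
noncomputable def derangementSum (N : ℕ) : ℝ :=
  ∑ m ∈ Finset.range (N + 1), (numDerangements m : ℝ) / m.factorial

theorem numDerangements_div_factorial (n : ℕ) :
    (numDerangements n : ℝ) / n.factorial
      = ∑ k ∈ Finset.range (n + 1), (-1 : ℝ) ^ k / k.factorial := by
  induction n with
  | zero => simp
  | succ n ih =>
    rw [Finset.sum_range_succ, ← ih]
    have h := numDerangements_succ n
    have h' : (numDerangements (n + 1) : ℝ) = (n + 1) * numDerangements n - (-1) ^ n := by
      exact_mod_cast h
    rw [h', Nat.factorial_succ]
    push_cast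
    have := Nat.factorial_pos n
    field_simp
    ring

theorem numDerangements_div_factorial_le (n : ℕ) :
    (numDerangements n : ℝ) / n.factorial ≤
      (Real.exp 1)⁻¹ + (n + 2) / ((n + 1).factorial * (n + 1)) := by
  rw [numDerangements_div_factorial, ← Real.exp_neg]
  have h := Real.exp_bound (x := -1) (by simp) (n := n + 1) (by omega)
  rw [abs_le] at h
  have h1 := h.1
  simp only [abs_neg, abs_one, one_pow, one_mul, Nat.succ_eq_add_one] at h1
  push_cast at h1
  have : ((n : ℝ) + 1 + 1) = n + 2 := by ring
  rw [this] at h1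
  linarith

/-- The terms up to m = 3 add up to 2 - 1/3!, and each later one exceeds 1/e by at most the tail of
the exponential series at -1. Strengthening the claim by -1/n! absorbs these errors, with equality
at n = 3. The case N = 2 lies below the induction base and only needs e ≥ 2. -/
theorem derangementSum_le {N : ℕ} (hN : 2 ≤ N) :
    derangementSum N ≤ ((N : ℝ) + 2 * Real.exp 1 - 3) / Real.exp 1 := by
  have he := Real.exp_pos 1
  have key : ∀ n, 3 ≤ n →
      derangementSum n ≤ n * (Real.exp 1)⁻¹ + 2 - 3 * (Real.exp 1)⁻¹ - 1 / n.factorial := by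
    intro n hn
    induction n, hn using Nat.le_induction with
    | base =>
      simp [derangementSum, Finset.sum_range_succ, numDerangements, Nat.factorial]
      norm_num
    | succ n hn ih =>
      have h := numDerangements_div_factorial_le (n + 1)
      rw [derangementSum, Finset.sum_range_succ]
      rw [derangementSum] at ih
      have h2 : (((n + 1 : ℕ) : ℝ) + 2) / ((n + 1 + 1).factorial * ((n + 1 : ℕ) + 1))
          ≤ 1 / n.factorial - 1 / (n + 1).factorial := by
        have hf : (0 : ℝ) < n.factorial := by exact_mod_cast Nat.factorial_pos n
        have hn' : (3 : ℝ) ≤ n := by exact_mod_cast hn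
        rw [Nat.factorial_succ (n + 1), Nat.factorial_succ n]
        push_cast
        have e : 1 / (n.factorial : ℝ) - 1 / ((n + 1) * n.factorial)
            = (n * (n + 2) * (n + 2)) / ((n + 1 + 1) * ((n + 1) * n.factorial) * (n + 1 + 1)) := by
          field_simp
          ring
        rw [e]
        gcongr
        have hn0 := Nat.cast_nonneg (α := ℝ) n
        nlinarith [mul_nonneg hn0 hn0, mul_nonneg (mul_nonneg hn0 hn0) hn0]
      push_cast at *
      linarith
  have h2 : ((N : ℝ) + 2 * Real.exp 1 - 3) / Real.exp 1
      = N * (Real.exp 1)⁻¹ + 2 - 3 * (Real.exp 1)⁻¹ := by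
    field_simp
  rw [h2]
  rcases hN.eq_or_lt with rfl | h
  · have : (Real.exp 1)⁻¹ ≤ 2⁻¹ := by
      gcongr
      linarith [Real.add_one_le_exp 1]
    simp [derangementSum, Finset.sum_range_succ, numDerangements, Nat.factorial]
    linarith
  · have := key N h
    have : (0 : ℝ) ≤ 1 / N.factorial := by positivity
    linarith

/-! ### Counting pairs and quadruples of permutations -/

section Permutations

open Equiv

theorem card_perm_support_eq {α : Type*} [Fintype α] [DecidableEq α] (S : Finset α) :
    (Finset.univ.filter fun ρ : Perm α => ρ.support = S).card = numDerangements S.card := by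
  have h := Fintype.card_congr (derangements.subtypeEquiv (fun a : α => a ∈ S))
  rw [card_derangements_eq_numDerangements, Fintype.card_coe] at h
  rw [h, Fintype.card_subtype]
  congr 1
  ext ρ
  simp only [Finset.mem_filter, Finset.mem_univ, true_and, Finset.ext_iff, Perm.mem_support,
    Function.mem_fixedPoints, Function.IsFixedPt]
  exact forall_congr' fun a => by tauto

theorem card_perm_fixing_support {α : Type*} [Fintype α] [DecidableEq α] (ρ : Perm α) :
    (Finset.univ.filter fun η : Perm α => ∀ i, ρ i ≠ i → η i = i).card
      = (Fintype.card α - ρ.support.card).factorial := by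
  have h := Fintype.card_congr (Perm.subtypeEquivSubtypePerm (fun a : α => ρ a = a))
  rw [Fintype.card_perm, Fintype.card_subtype] at h
  rw [Fintype.card_subtype] at h
  rw [← Finset.card_compl]
  convert h.symm using 3
  ext a
  simp

/-- Sort the pairs by the support S of the first permutation: it is a derangement of S, and the
second is an arbitrary permutation of the complement. With |S| = m the count is C(N, m) d_m (N - m)!
= N! d_m / m!. -/
theorem card_disjoint_perm_pairs (N : ℕ) :
    ((Finset.univ.filter fun p : Perm (Fin N) × Perm (Fin N) =>
        ∀ i, p.1 i ≠ i → p.2 i = i).card : ℝ) = N.factorial * derangementSum N := by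
  have h1 : (Finset.univ.filter fun p : Perm (Fin N) × Perm (Fin N) =>
        ∀ i, p.1 i ≠ i → p.2 i = i).card
      = ∑ ρ : Perm (Fin N), (N - ρ.support.card).factorial := by
    rw [Finset.card_filter, Fintype.sum_prod_type]
    refine Finset.sum_congr rfl fun ρ _ => ?_
    rw [← Finset.card_filter]
    have h := card_perm_fixing_support ρ
    rw [Fintype.card_fin] at h
    convert h
  have h2 : ∑ ρ : Perm (Fin N), (N - ρ.support.card).factorial
      = ∑ S : Finset (Fin N), numDerangements S.card * (N - S.card).factorial := by
    rw [← Finset.sum_fiberwise Finset.univ (fun ρ : Perm (Fin N) => ρ.support)]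
    refine Finset.sum_congr rfl fun S _ => ?_
    rw [← card_perm_support_eq, ← smul_eq_mul, ← Finset.sum_const]
    refine Finset.sum_congr rfl fun ρ hρ => ?_
    rw [(Finset.mem_filter.mp hρ).2]
  rw [h1, h2, ← Finset.powerset_univ,
    Finset.sum_powerset_apply_card fun m => numDerangements m * (N - m).factorial,
    Finset.card_univ, Fintype.card_fin, derangementSum, Finset.mul_sum]
  push_cast
  refine Finset.sum_congr rfl fun m hm => ?_
  have hm' : m ≤ N := Nat.lt_succ_iff.mp (Finset.mem_range.mp hm)
  have hc : (N.choose m : ℝ) * m.factorial * (N - m).factorial = N.factorial := by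
    exact_mod_cast Nat.choose_mul_factorial_mul_factorial hm'
  have : (m.factorial : ℝ) ≠ 0 := by exact_mod_cast (Nat.factorial_pos m).ne'
  rw [smul_eq_mul, ← hc]
  field_simp
  push_cast
  ring

/-- Send (σ, σ', τ, τ') to σ together with ρ = σ⁻¹τ and η = τ⁻¹σ'. Where τ i = σ i, ρ fixes i; where
τ i = σ' i, η fixes i; so the supports are disjoint. The image determines σ, τ, σ', and the matching
condition then determines τ'. -/
theorem card_matching_perm_quadruples_le (N : ℕ) :
    ((Finset.univ.filter fun p : (Perm (Fin N) × Perm (Fin N)) × (Perm (Fin N) × Perm (Fin N)) =>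
        ∀ i, (p.2.1 i = p.1.1 i ∧ p.2.2 i = p.1.2 i) ∨
          (p.2.1 i = p.1.2 i ∧ p.2.2 i = p.1.1 i)).card : ℝ)
      ≤ N.factorial * (N.factorial * derangementSum N) := by
  rw [← card_disjoint_perm_pairs]
  have hN : N.factorial = (Finset.univ : Finset (Perm (Fin N))).card := by
    rw [Finset.card_univ, Fintype.card_perm, Fintype.card_fin]
  rw [hN]
  norm_cast
  rw [← Finset.card_product]
  refine Finset.card_le_card_of_injOn
    (fun p => (p.1.1, (p.1.1⁻¹ * p.2.1, p.2.1⁻¹ * p.1.2))) ?_ ?_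
  · rintro ⟨⟨σ, σ'⟩, τ, τ'⟩ hp
    simp only [Finset.coe_filter, Finset.mem_univ, true_and, Set.mem_ofPred_eq] at hp
    simp only [Finset.coe_product, Finset.coe_univ, Finset.coe_filter, Finset.mem_univ, true_and,
      Set.mem_prod, Set.mem_univ, Set.mem_ofPred_eq, Perm.mul_apply]
    intro i hi
    rcases hp i with h | h
    · exact absurd (by rw [h.1]; simp) hi
    · rw [← h.1]; simp
  · rintro ⟨⟨σ, σ'⟩, τ, τ'⟩ hp ⟨⟨σ₂, σ₂'⟩, τ₂, τ₂'⟩ hp₂ heq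
    simp only [Finset.coe_filter, Finset.mem_univ, true_and, Set.mem_ofPred_eq] at hp hp₂
    simp only [Prod.mk.injEq] at heq
    obtain ⟨rfl, h1, h2⟩ := heq
    obtain rfl := mul_left_cancel h1
    obtain rfl := mul_left_cancel h2
    have : τ' = τ₂' := by
      ext i
      rcases hp i with h | h <;> rcases hp₂ i with h' | h' <;> simp_all
    rw [this]

end Permutations

/-! ### Characters, momenta and plane waves -/

/-- The integer momentum index attached to `k : Fin L`. -/
def momentumIndex {L : ℕ} (k : Fin L) : ℤ := (k : ℤ) - ((L : ℤ) - 1) / 2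

/-- The character `e^{2π i m / L}`. -/
noncomputable def rootExp (L : ℕ) (m : ℤ) : ℂ := Complex.exp (2 * Real.pi * Complex.I * m / L)

theorem rootExp_add (L : ℕ) (m n : ℤ) : rootExp L (m + n) = rootExp L m * rootExp L n := by
  rw [rootExp, rootExp, rootExp, ← Complex.exp_add]
  congr 1
  push_cast
  ring

theorem rootExp_zero (L : ℕ) : rootExp L 0 = 1 := by simp [rootExp]

theorem rootExp_self_mul (L : ℕ) [NeZero L] (m : ℤ) : rootExp L (L * m) = 1 := by
  rw [rootExp, Complex.exp_eq_one_iff]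
  refine ⟨m, ?_⟩
  have : (L : ℂ) ≠ 0 := by exact_mod_cast NeZero.ne L
  push_cast
  field_simp

theorem rootExp_neg (L : ℕ) (m : ℤ) : rootExp L (-m) = star (rootExp L m) := by
  rw [rootExp, rootExp, Complex.star_def, ← Complex.exp_conj]
  congr 1
  simp [Complex.conj_ofNat, neg_div]

theorem rootExp_eq_one_iff (L : ℕ) [NeZero L] (m : ℤ) : rootExp L m = 1 ↔ (L : ℤ) ∣ m := by
  constructor
  · intro h
    rw [rootExp, Complex.exp_eq_one_iff] at h
    obtain ⟨n, hn⟩ := h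
    refine ⟨n, ?_⟩
    have hL : (L : ℂ) ≠ 0 := by exact_mod_cast NeZero.ne L
    have h2 : (2 * Real.pi * Complex.I : ℂ) ≠ 0 := Complex.two_pi_I_ne_zero
    have : (2 * Real.pi * Complex.I : ℂ) * m = (2 * Real.pi * Complex.I) * (L * n) := by
      field_simp at hn ⊢
      linear_combination hn
    exact_mod_cast mul_left_cancel₀ h2 this
  · rintro ⟨n, rfl⟩
    exact rootExp_self_mul L n

theorem rootExp_mul_nat (L : ℕ) (m : ℤ) (n : ℕ) : rootExp L (n * m) = rootExp L m ^ n := by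
  induction n with
  | zero => simp [rootExp_zero]
  | succ n ih =>
    rw [pow_succ, ← ih, ← rootExp_add]
    congr 1
    push_cast
    ring

theorem sum_rootExp (L : ℕ) [NeZero L] (m : ℤ) :
    ∑ x : Fin L, rootExp L ((x : ℕ) * m) = if (L : ℤ) ∣ m then (L : ℂ) else 0 := by
  simp_rw [rootExp_mul_nat]
  rw [Fin.sum_univ_eq_sum_range (fun n => rootExp L m ^ n)]
  split_ifs with h
  · rw [(rootExp_eq_one_iff L m).mpr h]
    simp
  · have h1 : rootExp L m ≠ 1 := fun h' => h ((rootExp_eq_one_iff L m).mp h')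
    rw [geom_sum_eq h1, ← rootExp_mul_nat, rootExp_self_mul]
    simp

theorem sum_rootExp_momentumIndex (L : ℕ) [NeZero L] (m : ℤ) :
    ∑ k : Fin L, rootExp L (momentumIndex k * m) = if (L : ℤ) ∣ m then (L : ℂ) else 0 := by
  have h : ∀ k : Fin L, rootExp L (momentumIndex k * m)
      = rootExp L ((k : ℕ) * m) * rootExp L (-(((L : ℤ) - 1) / 2) * m) := by
    intro k
    rw [← rootExp_add, momentumIndex]
    congr 1
    ring
  simp_rw [h]
  rw [← Finset.sum_mul, sum_rootExp]
  split_ifs with hd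
  · rw [(rootExp_eq_one_iff L _).mpr (Dvd.dvd.mul_left hd _), mul_one]
  · simp

theorem momentumIndex_injective (L : ℕ) : Function.Injective (momentumIndex (L := L)) := by
  intro k k' h
  simp only [momentumIndex, sub_left_inj, Nat.cast_inj] at h
  exact Fin.ext h

/-- The single-particle energy `2 cos (2πν/L + θ)`. -/
noncomputable def bandEnergy {L : ℕ} (θ : ℝ) (k : Fin L) : ℝ :=
  2 * Real.cos (2 * Real.pi / L * momentumIndex k + θ)

theorem sum_bandEnergy_injOn {L N : ℕ} (hL : Odd L) {θ : ℝ} (hnd : Nondegenerate L N θ)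
    {κ κ' : Finset (Fin L)} (hκ : κ.card = N) (hκ' : κ'.card = N)
    (h : ∑ k ∈ κ, bandEnergy θ k = ∑ k ∈ κ', bandEnergy θ k) : κ = κ' := by
  have hmem : ∀ S : Finset (Fin L), S.card = N →
      S.map ⟨_, momentumIndex_injective L⟩ ∈ (momentumIndices L).powersetCard N := by
    intro S hS
    rw [Finset.mem_powersetCard]
    refine ⟨fun ν hν => ?_, by rw [Finset.card_map, hS]⟩
    obtain ⟨k, -, rfl⟩ := Finset.mem_map.mp hν
    obtain ⟨m, rfl⟩ := hL
    have := k.2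
    simp only [Function.Embedding.coeFn_mk, momentumIndex, momentumIndices, Finset.mem_Icc]
    push_cast
    omega
  have henergy : ∀ S : Finset (Fin L),
      energy L θ (S.map ⟨_, momentumIndex_injective L⟩) = ∑ k ∈ S, bandEnergy θ k := by
    intro S
    rw [energy, Finset.sum_map, Finset.mul_sum]
    rfl
  have := hnd _ (hmem κ hκ) _ (hmem κ' hκ') (by rw [henergy, henergy, h])
  exact Finset.map_injective _ this

/-- The normalized plane wave with momentum `2πν/L`. -/
noncomputable def planeWave {L : ℕ} (k x : Fin L) : ℂ :=
  ((Real.sqrt L)⁻¹ : ℝ) * rootExp L (momentumIndex k * (x : ℕ))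

theorem sum_star_planeWave_mul (L : ℕ) [NeZero L] (k k' : Fin L) :
    ∑ x, star (planeWave k x) * planeWave k' x = if k = k' then 1 else 0 := by
  have hL : (0 : ℝ) < L := by exact_mod_cast NeZero.pos L
  have h : ∀ x : Fin L, star (planeWave k x) * planeWave k' x
      = (L : ℂ)⁻¹ * rootExp L ((x : ℕ) * (momentumIndex k' - momentumIndex k)) := by
    intro x
    have hs : (((Real.sqrt L)⁻¹ : ℝ) : ℂ) * (((Real.sqrt L)⁻¹ : ℝ) : ℂ) = (L : ℂ)⁻¹ := by
      rw [← Complex.ofReal_mul, ← mul_inv, Real.mul_self_sqrt hL.le]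
      simp
    have e : ((x : ℕ) : ℤ) * (momentumIndex k' - momentumIndex k)
        = momentumIndex k' * (x : ℕ) + -(momentumIndex k * (x : ℕ)) := by ring
    rw [e, rootExp_add, rootExp_neg, ← hs, planeWave, planeWave, star_mul', Complex.star_def,
      Complex.conj_ofReal]
    ring
  simp_rw [h]
  rw [← Finset.mul_sum, sum_rootExp]
  have hd : (L : ℤ) ∣ momentumIndex k' - momentumIndex k ↔ k = k' := by
    constructor
    · intro hd
      have h1 := k.2
      have h2 := k'.2
      have := Int.eq_zero_of_abs_lt_dvd hd (by
        simp only [momentumIndex]; rw [abs_lt]; omega)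
      exact momentumIndex_injective L (by omega : momentumIndex k = momentumIndex k')
    · rintro rfl
      simp
  simp only [hd]
  split_ifs
  · have : (L : ℂ) ≠ 0 := by exact_mod_cast NeZero.ne L
    field_simp
  · simp

theorem finRotate_dvd_sub {L : ℕ} (x : Fin L) :
    (L : ℤ) ∣ ((finRotate L x : Fin L) : ℕ) - ((x : ℕ) + 1 : ℤ) := by
  obtain ⟨n, rfl⟩ : ∃ n, L = n + 1 := ⟨L - 1, by have := x.2; omega⟩
  by_cases h : (x : ℕ) < n
  · rw [finRotate_of_lt h]
    simp
  · have : x = Fin.last n := Fin.ext (by have := x.2; simp; omega)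
    subst this
    rw [finRotate_last]
    simp
    exact ⟨-1, by ring⟩

/-- Plane waves are eigenfunctions of the cyclic shift; the wrap-around is invisible because
`rootExp` is L-periodic. -/
theorem planeWave_finRotate {L : ℕ} [NeZero L] (k x : Fin L) :
    planeWave k (finRotate L x) = rootExp L (momentumIndex k) * planeWave k x := by
  obtain ⟨c, hc⟩ := finRotate_dvd_sub x
  have : momentumIndex k * ((finRotate L x : Fin L) : ℕ)
      = momentumIndex k + (momentumIndex k * (x : ℕ) + L * (momentumIndex k * c)) := by
    linear_combination momentumIndex k * hc
  rw [planeWave, planeWave, this, rootExp_add, rootExp_add, rootExp_self_mul]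
  ring

theorem bandEnergy_eq {L : ℕ} (θ : ℝ) (k : Fin L) :
    Complex.exp (Complex.I * θ) * rootExp L (momentumIndex k)
      + Complex.exp (-(Complex.I * θ)) * rootExp L (-momentumIndex k) = (bandEnergy θ k : ℂ) := by
  rw [rootExp, rootExp, ← Complex.exp_add, ← Complex.exp_add, bandEnergy]
  push_cast
  rw [Complex.cos, mul_div_cancel₀ _ two_ne_zero]
  congr 2 <;> ring

/-! ### Canonical anticommutation relations -/

theorem creation_apply {L : ℕ} (x : Fin L) (ψ : Fock L) (S : Finset (Fin L)) :
    creation x ψ S = if x ∈ S then jwSign x S * ψ (S.erase x) else 0 := rfl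

theorem jwSign_mul_self {L : ℕ} (x : Fin L) (S : Finset (Fin L)) :
    jwSign x S * jwSign x S = 1 := by
  rw [jwSign, ← mul_pow]; simp

theorem star_jwSign {L : ℕ} (x : Fin L) (S : Finset (Fin L)) : star (jwSign x S) = jwSign x S := by
  simp [jwSign]

theorem jwSign_insert {L : ℕ} (x : Fin L) {y : Fin L} {S : Finset (Fin L)} (hy : y ∉ S) :
    jwSign x (insert y S) = if y < x then -jwSign x S else jwSign x S := by
  rw [jwSign, Finset.filter_insert]
  split_ifs with h
  · rw [Finset.card_insert_of_notMem (by simp [hy]), pow_succ, jwSign]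
    ring
  · rfl

theorem jwSign_erase {L : ℕ} (x : Fin L) {y : Fin L} {S : Finset (Fin L)} (hy : y ∈ S) :
    jwSign x (S.erase y) = if y < x then -jwSign x S else jwSign x S := by
  have h := jwSign_insert x (Finset.notMem_erase y S)
  rw [Finset.insert_erase hy] at h
  rw [h]
  split_ifs <;> simp

theorem creation_single {L : ℕ} (x : Fin L) (S : Finset (Fin L)) :
    creation x (EuclideanSpace.single S 1)
      = if x ∈ S then 0 else jwSign x S • EuclideanSpace.single (insert x S) 1 := by
  ext T
  rw [creation_apply]
  by_cases hx : x ∈ S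
  · rw [if_pos hx]
    by_cases hT : x ∈ T
    · have : T.erase x ≠ S := by rintro rfl; simp at hx
      simp [this]
    · simp [hT]
  · rw [if_neg hx]
    by_cases hT : x ∈ T
    · by_cases hTS : T.erase x = S
      · subst hTS
        simp [hT, Finset.insert_erase hT, jwSign_erase x hT]
      · have : T ≠ insert x S := by
          rintro rfl
          exact hTS (Finset.erase_insert hx)
        simp [hTS, this]
    · have : T ≠ insert x S := by rintro rfl; simp at hT
      simp [hT, this]

theorem annihilation_apply {L : ℕ} (x : Fin L) (ψ : Fock L) (S : Finset (Fin L)) :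
    annihilation x ψ S = if x ∈ S then 0 else jwSign x S * ψ (insert x S) := by
  have h : annihilation x ψ S = inner ℂ (EuclideanSpace.single S (1 : ℂ)) (annihilation x ψ) := by
    rw [EuclideanSpace.inner_single_left]; simp
  rw [h, annihilation, ContinuousLinearMap.adjoint_inner_right, creation_single]
  split_ifs
  · simp
  · rw [inner_smul_left, EuclideanSpace.inner_single_left, ← Complex.star_def, star_jwSign]
    simp

/-- Removing the smaller of two occupied sites flips the Jordan–Wigner sign of the larger one, and
not conversely, so the two orders differ by exactly one sign. -/
theorem creation_mul_creation {L : ℕ} (x y : Fin L) :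
    creation x * creation y = -(creation y * creation x) := by
  ext ψ S
  simp only [mul_apply_eq_comp, neg_apply, PiLp.neg_apply,
    creation_apply, Finset.mem_erase]
  by_cases hx : x ∈ S <;> by_cases hy : y ∈ S
  · rcases lt_trichotomy x y with h | h | h
    · simp [hx, hy, h.ne, h.ne', jwSign_erase, h, h.not_gt, Finset.erase_right_comm (a := x)]
      ring
    · simp [h]
    · simp [hx, hy, h.ne, h.ne', jwSign_erase, h, h.not_gt, Finset.erase_right_comm (a := x)]
      ring
  all_goals simp [hx, hy]

theorem annihilation_mul_creation {L : ℕ} (x y : Fin L) :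
    annihilation x * creation y + creation y * annihilation x = if x = y then 1 else 0 := by
  ext ψ S
  rcases lt_trichotomy x y with h | rfl | h
  · rw [if_neg h.ne]
    by_cases hx : x ∈ S <;> by_cases hy : y ∈ S <;>
      simp [creation_apply, annihilation_apply, hx, hy, h.ne, h.ne', jwSign_erase, jwSign_insert,
        h, h.not_gt, Finset.erase_insert_of_ne]
    ring
  · by_cases hx : x ∈ S
    · simp [creation_apply, annihilation_apply, hx, jwSign_erase, ← mul_assoc, jwSign_mul_self]
    · simp [creation_apply, annihilation_apply, hx, jwSign_insert, ← mul_assoc, jwSign_mul_self]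
  · rw [if_neg h.ne']
    by_cases hx : x ∈ S <;> by_cases hy : y ∈ S <;>
      simp [creation_apply, annihilation_apply, hx, hy, h.ne, h.ne', jwSign_erase, jwSign_insert,
        h, h.not_gt, Finset.erase_insert_of_ne]
    ring

/-! ### Mode operators and diagonalisation of the Hamiltonian -/

/-- The creation operator of the single-particle state `f`. -/
noncomputable def createState {L : ℕ} (f : Fin L → ℂ) : Fock L →L[ℂ] Fock L := ∑ x, f x • creation x

/-- The annihilation operator of the single-particle state `f`. -/
noncomputable def annihilateState {L : ℕ} (f : Fin L → ℂ) : Fock L →L[ℂ] Fock L :=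
  ∑ x, star (f x) • annihilation x

theorem inner_createState_left {L : ℕ} (f : Fin L → ℂ) (ψ φ : Fock L) :
    inner ℂ (createState f ψ) φ = inner ℂ ψ (annihilateState f φ) := by
  simp only [createState, annihilateState, sum_apply, sum_inner, inner_sum,
    smul_apply, inner_smul_left, inner_smul_right, annihilation,
    ContinuousLinearMap.adjoint_inner_right]
  rfl

theorem createState_apply {L : ℕ} (f : Fin L → ℂ) (ψ : Fock L) :
    createState f ψ = ∑ x, f x • creation x ψ := by
  simp only [createState, sum_apply, smul_apply]

theorem annihilateState_apply {L : ℕ} (f : Fin L → ℂ) (ψ : Fock L) :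
    annihilateState f ψ = ∑ x, star (f x) • annihilation x ψ := by
  simp only [annihilateState, sum_apply, smul_apply]

theorem creation_creation_apply {L : ℕ} (x y : Fin L) (ψ : Fock L) :
    creation x (creation y ψ) = -creation y (creation x ψ) := by
  have h := congrArg (fun A : Fock L →L[ℂ] Fock L => A ψ) (creation_mul_creation x y)
  simpa only [mul_apply_eq_comp, neg_apply] using h

theorem annihilation_creation_apply {L : ℕ} (x y : Fin L) (ψ : Fock L) :
    annihilation x (creation y ψ) = (if x = y then ψ else 0) - creation y (annihilation x ψ) := by
  have h := congrArg (fun A : Fock L →L[ℂ] Fock L => A ψ) (annihilation_mul_creation x y)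
  rw [eq_sub_iff_add_eq]
  simp only [mul_apply_eq_comp, add_apply] at h
  rw [h]
  split_ifs <;> rfl

theorem annihilateState_createState_apply {L : ℕ} (f g : Fin L → ℂ) (ψ : Fock L) :
    annihilateState f (createState g ψ)
      = (∑ x, star (f x) * g x) • ψ - createState g (annihilateState f ψ) := by
  have h1 : annihilateState f (createState g ψ)
      = ∑ x, ∑ y, (star (f x) * g y) • annihilation x (creation y ψ) := by
    rw [Finset.sum_comm]
    simp only [annihilateState_apply, createState_apply, map_sum, map_smul, Finset.smul_sum,
      smul_smul]
    exact Finset.sum_congr rfl fun y _ => Finset.sum_congr rfl fun x _ => by rw [mul_comm]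
  have h2 : createState g (annihilateState f ψ)
      = ∑ x, ∑ y, (star (f x) * g y) • creation y (annihilation x ψ) := by
    simp only [annihilateState_apply, createState_apply, map_sum, map_smul, Finset.smul_sum,
      smul_smul]
  rw [h1, h2, eq_sub_iff_add_eq, ← Finset.sum_add_distrib, Finset.sum_smul]
  refine Finset.sum_congr rfl fun x _ => ?_
  rw [← Finset.sum_add_distrib]
  simp_rw [← smul_add, annihilation_creation_apply, sub_add_cancel]
  simp

theorem annihilateState_vacuum {L : ℕ} (f : Fin L → ℂ) : annihilateState f (vacuum L) = 0 := by
  ext S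
  simp [annihilateState_apply, annihilation_apply, vacuum]

theorem hop_creation_apply {L : ℕ} (x y z : Fin L) (ψ : Fock L) :
    creation x (annihilation y (creation z ψ))
      = creation z (creation x (annihilation y ψ)) + if y = z then creation x ψ else 0 := by
  rw [annihilation_creation_apply, map_sub, creation_creation_apply x z, sub_neg_eq_add, add_comm]
  split_ifs <;> simp

theorem hamiltonian_apply {L : ℕ} (θ : ℝ) (ψ : Fock L) :
    hamiltonian L θ ψ = ∑ x : Fin L,
      (Complex.exp (Complex.I * θ) • creation x (annihilation (finRotate L x) ψ) +
        Complex.exp (-(Complex.I * θ)) • creation (finRotate L x) (annihilation x ψ)) := by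
  simp only [hamiltonian, sum_apply, smul_apply, add_apply, mul_apply_eq_comp]

theorem hamiltonian_creation_apply {L : ℕ} (θ : ℝ) (z : Fin L) (ψ : Fock L) :
    hamiltonian L θ (creation z ψ) = creation z (hamiltonian L θ ψ)
      + (Complex.exp (Complex.I * θ) • creation ((finRotate L).symm z) ψ
        + Complex.exp (-(Complex.I * θ)) • creation (finRotate L z) ψ) := by
  simp only [hamiltonian_apply, hop_creation_apply, map_sum, map_add, map_smul]
  have h1 : ∑ x : Fin L, Complex.exp (Complex.I * θ) •
      (if finRotate L x = z then creation x ψ else 0)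
        = Complex.exp (Complex.I * θ) • creation ((finRotate L).symm z) ψ := by
    rw [Finset.sum_eq_single ((finRotate L).symm z)]
    · rw [if_pos (Equiv.apply_symm_apply _ _)]
    · intro b _ hb
      rw [if_neg, smul_zero]
      rintro rfl
      exact hb (Equiv.symm_apply_apply _ _).symm
    · exact fun h => absurd (Finset.mem_univ _) h
  have h2 : ∑ x : Fin L, Complex.exp (-(Complex.I * θ)) •
      (if x = z then creation (finRotate L x) ψ else 0)
        = Complex.exp (-(Complex.I * θ)) • creation (finRotate L z) ψ := by
    simp
  rw [← h1, ← h2, ← Finset.sum_add_distrib, ← Finset.sum_add_distrib]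
  refine Finset.sum_congr rfl fun x _ => ?_
  simp only [smul_add]
  abel

/-- The commutator of a quadratic Hamiltonian with a creation operator is the creation operator of
the hopped one-particle state. Plane waves are eigenfunctions of the hopping, so each such operator
raises the energy by `bandEnergy`. -/
theorem hamiltonian_createState_planeWave {L : ℕ} [NeZero L] (θ : ℝ) (k : Fin L) (ψ : Fock L) :
    hamiltonian L θ (createState (planeWave k) ψ)
      = createState (planeWave k) (hamiltonian L θ ψ)
        + (bandEnergy θ k : ℂ) • createState (planeWave k) ψ := by
  rw [createState_apply, map_sum]
  simp_rw [map_smul, hamiltonian_creation_apply, smul_add]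
  rw [Finset.sum_add_distrib, ← createState_apply, add_right_inj, Finset.sum_add_distrib]
  have h1 : ∑ x, planeWave k x • Complex.exp (Complex.I * θ) • creation ((finRotate L).symm x) ψ
      = (Complex.exp (Complex.I * θ) * rootExp L (momentumIndex k)) •
        createState (planeWave k) ψ := by
    rw [← Equiv.sum_comp (finRotate L), createState_apply, Finset.smul_sum]
    refine Finset.sum_congr rfl fun x _ => ?_
    rw [planeWave_finRotate, Equiv.symm_apply_apply, smul_smul, smul_smul]
    congr 1
    ring
  have h2 : ∑ x, planeWave k x • Complex.exp (-(Complex.I * θ)) • creation (finRotate L x) ψ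
      = (Complex.exp (-(Complex.I * θ)) * rootExp L (-momentumIndex k)) •
        createState (planeWave k) ψ := by
    rw [createState_apply, Finset.smul_sum, ← Equiv.sum_comp (finRotate L) fun x =>
      (Complex.exp (-(Complex.I * θ)) * rootExp L (-momentumIndex k)) •
        planeWave k x • creation x ψ]
    refine Finset.sum_congr rfl fun x _ => ?_
    have e : rootExp L (-momentumIndex k) * rootExp L (momentumIndex k) = 1 := by
      rw [← rootExp_add, neg_add_cancel, rootExp_zero]
    rw [planeWave_finRotate, smul_smul, smul_smul]
    congr 1
    linear_combination (-planeWave k x * Complex.exp (-(Complex.I * θ))) * e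
  rw [h1, h2, ← add_smul, bandEnergy_eq, createState_apply]

theorem hamiltonian_vacuum (L : ℕ) (θ : ℝ) : hamiltonian L θ (vacuum L) = 0 := by
  rw [hamiltonian_apply]
  refine Finset.sum_eq_zero fun x _ => ?_
  have h : ∀ y : Fin L, annihilation y (vacuum L) = 0 := by
    intro y
    ext S
    simp [annihilation_apply, vacuum]
  simp [h]

theorem inner_hamiltonian_left {L : ℕ} (θ : ℝ) (ψ φ : Fock L) :
    inner ℂ (hamiltonian L θ ψ) φ = inner ℂ ψ (hamiltonian L θ φ) := by
  have hc : ∀ (x : Fin L) (a b : Fock L),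
      inner ℂ (creation x a) b = inner ℂ a (annihilation x b) := fun x a b => by
    rw [annihilation, ContinuousLinearMap.adjoint_inner_right]
  have ha : ∀ (x : Fin L) (a b : Fock L),
      inner ℂ (annihilation x a) b = inner ℂ a (creation x b) := fun x a b => by
    rw [annihilation, ContinuousLinearMap.adjoint_inner_left]
  rw [hamiltonian_apply, hamiltonian_apply, sum_inner, inner_sum]
  refine Finset.sum_congr rfl fun x _ => ?_
  rw [inner_add_left, inner_add_right, inner_smul_left, inner_smul_left, inner_smul_right,
    inner_smul_right, hc, hc, ha, ha, ← Complex.exp_conj, ← Complex.exp_conj, add_comm]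
  simp

/-! ### Slater determinants -/

/-- The product state `a†(f₀) ⋯ a†(f_{n-1}) |Φ_vac⟩`. -/
noncomputable def slater {L : ℕ} : {n : ℕ} → (Fin n → Fin L → ℂ) → Fock L
  | 0, _ => vacuum L
  | _ + 1, f => createState (f 0) (slater fun i => f i.succ)

/-- The annihilator of a mode orthogonal to all occupied ones anticommutes through to the vacuum,
which it kills. -/
theorem annihilateState_slater {L n : ℕ} (g : Fin L → ℂ) (f : Fin n → Fin L → ℂ)
    (h : ∀ i, ∑ x, star (g x) * f i x = 0) : annihilateState g (slater f) = 0 := by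
  induction n with
  | zero => exact annihilateState_vacuum g
  | succ n ih =>
    rw [slater, annihilateState_createState_apply, h, ih _ fun i => h i.succ]
    simp

theorem inner_slater_self {L n : ℕ} (f : Fin n → Fin L → ℂ)
    (h : ∀ i j, ∑ x, star (f i x) * f j x = if i = j then 1 else 0) :
    inner ℂ (slater f) (slater f) = (1 : ℂ) := by
  induction n with
  | zero => simp [slater, vacuum]
  | succ n ih =>
    rw [slater, inner_createState_left, annihilateState_createState_apply,
      annihilateState_slater _ _ fun i => by rw [h, if_neg (Fin.succ_ne_zero i).symm], h]
    simpa using ih (fun i => f i.succ) fun i j => by rw [h]; simp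

theorem hamiltonian_slater_planeWave {L n : ℕ} [NeZero L] (θ : ℝ) (k : Fin n → Fin L) :
    hamiltonian L θ (slater fun i => planeWave (k i))
      = ((∑ i, bandEnergy θ (k i) : ℝ) : ℂ) • slater fun i => planeWave (k i) := by
  induction n with
  | zero => simp [slater, hamiltonian_vacuum]
  | succ n ih =>
    rw [slater, hamiltonian_createState_planeWave, ih fun i => k i.succ, map_smul, ← add_smul,
      Fin.sum_univ_succ]
    push_cast
    rw [add_comm]

theorem jwSign_orderEmbOfFin {L n : ℕ} {S : Finset (Fin L)} (h : S.card = n) (j : Fin n) :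
    jwSign (S.orderEmbOfFin h j) S = (-1) ^ (j : ℕ) := by
  have : S.filter (fun y => y < S.orderEmbOfFin h j)
      = (Finset.Iio j).map (S.orderEmbOfFin h).toEmbedding := by
    trans (Finset.univ.map (S.orderEmbOfFin h).toEmbedding).filter
      (fun y => y < S.orderEmbOfFin h j)
    · rw [Finset.map_orderEmbOfFin_univ S h]
    rw [Finset.filter_map]
    congr 1
    ext i
    simp
  rw [jwSign, this, Finset.card_map, Fin.card_Iio]

theorem orderEmbOfFin_erase {L n : ℕ} {S : Finset (Fin L)} (h : S.card = n + 1) (j : Fin (n + 1))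
    (h' : (S.erase (S.orderEmbOfFin h j)).card = n) (i : Fin n) :
    (S.erase (S.orderEmbOfFin h j)).orderEmbOfFin h' i = S.orderEmbOfFin h (j.succAbove i) := by
  have := Finset.orderEmbOfFin_unique h' (f := fun i => S.orderEmbOfFin h (j.succAbove i))
    (fun i => by
      rw [Finset.mem_erase]
      exact ⟨fun he => Fin.succAbove_ne j i ((S.orderEmbOfFin h).injective he),
        Finset.orderEmbOfFin_mem S h _⟩)
    ((S.orderEmbOfFin h).strictMono.comp (Fin.strictMono_succAbove j))
  exact (congrFun this i).symm

theorem createState_apply_orderEmbOfFin {L n : ℕ} (f : Fin L → ℂ) (ψ : Fock L)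
    {S : Finset (Fin L)} (h : S.card = n) :
    createState f ψ S = ∑ j : Fin n, (-1) ^ (j : ℕ) * f (S.orderEmbOfFin h j)
      * ψ (S.erase (S.orderEmbOfFin h j)) := by
  have h1 : createState f ψ S = ∑ x ∈ S, f x * (jwSign x S * ψ (S.erase x)) := by
    rw [createState_apply]
    simp [creation_apply, Finset.sum_ite_mem]
  rw [h1]
  trans ∑ x ∈ Finset.univ.map (S.orderEmbOfFin h).toEmbedding,
    f x * (jwSign x S * ψ (S.erase x))
  · rw [Finset.map_orderEmbOfFin_univ S h]
  rw [Finset.sum_map]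
  refine Finset.sum_congr rfl fun j _ => ?_
  simp only [RelEmbedding.coe_toEmbedding, jwSign_orderEmbOfFin]
  ring

theorem slater_apply_of_card_ne {L n : ℕ} (f : Fin n → Fin L → ℂ) {S : Finset (Fin L)}
    (h : S.card ≠ n) : slater f S = 0 := by
  induction n generalizing S with
  | zero =>
    have : S ≠ ∅ := by rintro rfl; simp at h
    simp [slater, vacuum, this]
  | succ n ih =>
    rw [slater, createState_apply_orderEmbOfFin _ _ rfl]
    refine Finset.sum_eq_zero fun j _ => ?_
    rw [ih, mul_zero]
    rw [Finset.card_erase_of_mem (Finset.orderEmbOfFin_mem S rfl j)]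
    have := j.2
    omega

/-- The recursion defining `slater` is the Laplace expansion along row zero: removing the j-th
occupied site costs the Jordan–Wigner sign (-1)^j. -/
theorem slater_apply {L n : ℕ} (f : Fin n → Fin L → ℂ) {S : Finset (Fin L)} (h : S.card = n) :
    slater f S = Matrix.det (Matrix.of fun i j => f i (S.orderEmbOfFin h j)) := by
  induction n generalizing S with
  | zero =>
    obtain rfl := Finset.card_eq_zero.mp h
    simp [slater, vacuum]
  | succ n ih =>
    rw [slater, createState_apply_orderEmbOfFin _ _ h, Matrix.det_succ_row_zero]
    refine Finset.sum_congr rfl fun j _ => ?_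
    have h' : (S.erase (S.orderEmbOfFin h j)).card = n := by
      rw [Finset.card_erase_of_mem (Finset.orderEmbOfFin_mem S h j), h, Nat.add_sub_cancel]
    rw [ih _ h']
    congr 2
    ext i i'
    simp [orderEmbOfFin_erase]

theorem slater_mem_sector {L n : ℕ} (f : Fin n → Fin L → ℂ) : slater f ∈ sector L n :=
  fun _ hS => slater_apply_of_card_ne f hS

theorem prod_creation_vacuum {L n : ℕ} (s : Fin n → Fin L) :
    (List.ofFn fun j => creation (s j)).prod (vacuum L) = slater fun j => Pi.single (s j) 1 := by
  induction n with
  | zero => simp [slater]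
  | succ n ih =>
    rw [List.ofFn_succ, List.prod_cons, mul_apply_eq_comp, ih, slater, createState_apply]
    simp [Pi.single_apply]

theorem slater_single {L n : ℕ} {s : Fin n → Fin L} (hs : StrictMono s) :
    slater (fun j => Pi.single (s j) (1 : ℂ))
      = EuclideanSpace.single (Finset.univ.image s) 1 := by
  ext S
  by_cases h : S.card = n
  · rw [slater_apply _ h]
    by_cases hS : S = Finset.univ.image s
    · have he := Finset.orderEmbOfFin_unique h (f := s) (fun i => by rw [hS]; simp) hs
      rw [← he, hS]
      have : (Matrix.of fun i j => (Pi.single (s i) (1 : ℂ) : Fin L → ℂ) (s j))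
          = (1 : Matrix (Fin n) (Fin n) ℂ) := by
        ext i j
        simp [Pi.single_apply, Matrix.one_apply, hs.injective.eq_iff, eq_comm]
      rw [this]
      simp
    · obtain ⟨i, hi⟩ : ∃ i, s i ∉ S := by
        by_contra! hc
        refine hS (Finset.eq_of_subset_of_card_le ?_ ?_).symm
        · intro x hx
          obtain ⟨i, -, rfl⟩ := Finset.mem_image.mp hx
          exact hc i
        · rw [h, Finset.card_image_of_injective _ hs.injective, Finset.card_univ,
            Fintype.card_fin]
      rw [Matrix.det_eq_zero_of_row_eq_zero i]
      · simp [hS]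
      · intro j
        have : S.orderEmbOfFin h j ≠ s i := fun he => hi (he ▸ Finset.orderEmbOfFin_mem S h j)
        simp [this]
  · rw [slater_apply_of_card_ne _ h]
    have : S ≠ Finset.univ.image s := by
      rintro rfl
      rw [Finset.card_image_of_injective _ hs.injective, Finset.card_univ,
            Fintype.card_fin] at h
      exact h rfl
    simp [this]

/-! ### Configurations and the fourth moment of determinants -/

/-- The set of momenta or sites of `N` particles on the chain. -/
abbrev Config (L N : ℕ) : Type := {κ : Finset (Fin L) // κ.card = N}

/-- The increasing enumeration of a configuration. -/
def Config.enum {L N : ℕ} (κ : Config L N) : Fin N ↪o Fin L := κ.1.orderEmbOfFin κ.2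

theorem Config.image_enum {L N : ℕ} (κ : Config L N) : Finset.univ.image κ.enum = κ.1 := by
  ext x
  rw [Config.enum, ← Finset.mem_coe (s := κ.1), ← Finset.range_orderEmbOfFin κ.1 κ.2]
  simp

theorem Config.card_eq (L N : ℕ) : Fintype.card (Config L N) = L.choose N := by
  rw [Fintype.card_finset_len, Fintype.card_fin]

/-- Each configuration has N! orderings. Tuples with repeated entries appear only on the right,
whence the inequality. -/
theorem factorial_mul_sum_config_le {L N : ℕ} (F : (Fin N → Fin L) → ℝ) (hF : ∀ k, 0 ≤ F k)
    (hsymm : ∀ k (σ : Equiv.Perm (Fin N)), F (k ∘ σ) = F k) :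
    N.factorial * ∑ κ : Config L N, F κ.enum ≤ ∑ k, F k := by
  have h1 : N.factorial * ∑ κ : Config L N, F κ.enum
      = ∑ p : Config L N × Equiv.Perm (Fin N), F (p.1.enum ∘ p.2) := by
    rw [Fintype.sum_prod_type, Finset.mul_sum]
    refine Finset.sum_congr rfl fun κ _ => ?_
    simp [hsymm, Fintype.card_perm]
  rw [h1]
  have hinj : Function.Injective
      (fun p : Config L N × Equiv.Perm (Fin N) => (p.1.enum ∘ p.2 : Fin N → Fin L)) := by
    rintro ⟨κ, σ⟩ ⟨κ', σ'⟩ h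
    have himg : κ = κ' := by
      apply Subtype.ext
      rw [← κ.image_enum, ← κ'.image_enum]
      have h2 := congrArg (fun f : Fin N → Fin L => Finset.univ.image f) h
      simp only [← Finset.image_image, Finset.image_univ_equiv] at h2
      exact h2
    subst himg
    have : σ = σ' := by
      ext i
      exact congrArg _ (κ.enum.injective (congrFun h i))
    rw [this]
  rw [← Finset.sum_image (f := F) (g := fun p : Config L N × Equiv.Perm (Fin N) =>
    (p.1.enum ∘ p.2 : Fin N → Fin L)) hinj.injOn]
  exact Finset.sum_le_sum_of_subset_of_nonneg (Finset.subset_univ _) fun _ _ _ => hF _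

/-- Expanding det² · conj(det²) over four permutations turns the sum over tuples into a product over
i of one-variable sums. The signs have modulus one and disappear in the triangle inequality. -/
theorem sum_norm_det_pow_four_le {L N : ℕ} (g : Fin L → Fin N → ℂ) :
    ∑ k : Fin N → Fin L, ‖Matrix.det (Matrix.of fun i j => g (k i) j)‖ ^ 4
      ≤ ∑ p : (Equiv.Perm (Fin N) × Equiv.Perm (Fin N)) ×
          (Equiv.Perm (Fin N) × Equiv.Perm (Fin N)),
        ∏ i, ‖∑ x, g x (p.1.1 i) * g x (p.1.2 i) * star (g x (p.2.1 i) * g x (p.2.2 i))‖ := by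
  have hdet : ∀ k : Fin N → Fin L, Matrix.det (Matrix.of fun i j => g (k i) j)
      = ∑ σ : Equiv.Perm (Fin N), ((Equiv.Perm.sign σ : ℤ) : ℂ) * ∏ i, g (k i) (σ i) := by
    intro k
    rw [← Matrix.det_transpose, Matrix.det_apply']
    rfl
  have hsq : ∀ k : Fin N → Fin L, Matrix.det (Matrix.of fun i j => g (k i) j) ^ 2
      = ∑ p : Equiv.Perm (Fin N) × Equiv.Perm (Fin N),
        ((Equiv.Perm.sign p.1 : ℤ) * (Equiv.Perm.sign p.2 : ℤ) : ℂ)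
          * ∏ i, (g (k i) (p.1 i) * g (k i) (p.2 i)) := by
    intro k
    rw [hdet, sq, Finset.sum_mul_sum, Fintype.sum_prod_type]
    refine Finset.sum_congr rfl fun σ _ => Finset.sum_congr rfl fun τ _ => ?_
    rw [Finset.prod_mul_distrib]
    ring
  have hfour : ∀ k : Fin N → Fin L,
      ((‖Matrix.det (Matrix.of fun i j => g (k i) j)‖ ^ 4 : ℝ) : ℂ)
      = ∑ p : (Equiv.Perm (Fin N) × Equiv.Perm (Fin N)) ×
          (Equiv.Perm (Fin N) × Equiv.Perm (Fin N)),
        (((Equiv.Perm.sign p.1.1 : ℤ) * (Equiv.Perm.sign p.1.2 : ℤ) : ℂ)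
          * star (((Equiv.Perm.sign p.2.1 : ℤ) * (Equiv.Perm.sign p.2.2 : ℤ) : ℂ)))
          * ∏ i, (g (k i) (p.1.1 i) * g (k i) (p.1.2 i)
            * star (g (k i) (p.2.1 i) * g (k i) (p.2.2 i))) := by
    intro k
    have e : ((‖Matrix.det (Matrix.of fun i j => g (k i) j)‖ ^ 4 : ℝ) : ℂ)
        = Matrix.det (Matrix.of fun i j => g (k i) j) ^ 2
          * star (Matrix.det (Matrix.of fun i j => g (k i) j) ^ 2) := by
      rw [Complex.star_def, Complex.mul_conj, Complex.normSq_eq_norm_sq, norm_pow]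
      push_cast
      ring
    rw [e, hsq, star_sum, Finset.sum_mul_sum]
    conv_rhs => rw [Fintype.sum_prod_type]
    refine Finset.sum_congr rfl fun p _ => Finset.sum_congr rfl fun q _ => ?_
    rw [star_mul', star_prod, mul_mul_mul_comm, ← Finset.prod_mul_distrib]
  have hsum : ((∑ k : Fin N → Fin L, ‖Matrix.det (Matrix.of fun i j => g (k i) j)‖ ^ 4 : ℝ) : ℂ)
      = ∑ p : (Equiv.Perm (Fin N) × Equiv.Perm (Fin N)) ×
          (Equiv.Perm (Fin N) × Equiv.Perm (Fin N)),
        (((Equiv.Perm.sign p.1.1 : ℤ) * (Equiv.Perm.sign p.1.2 : ℤ) : ℂ)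
          * star (((Equiv.Perm.sign p.2.1 : ℤ) * (Equiv.Perm.sign p.2.2 : ℤ) : ℂ)))
          * ∏ i, ∑ x, g x (p.1.1 i) * g x (p.1.2 i) * star (g x (p.2.1 i) * g x (p.2.2 i)) := by
    rw [Complex.ofReal_sum]
    simp_rw [hfour]
    rw [Finset.sum_comm]
    refine Finset.sum_congr rfl fun p _ => ?_
    rw [← Finset.mul_sum, Finset.prod_univ_sum, Fintype.piFinset_univ]
  have hnn : 0 ≤ ∑ k : Fin N → Fin L, ‖Matrix.det (Matrix.of fun i j => g (k i) j)‖ ^ 4 :=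
    Finset.sum_nonneg fun _ _ => by positivity
  rw [← abs_of_nonneg hnn, ← Real.norm_eq_abs, ← Complex.norm_real, hsum]
  refine (norm_sum_le _ _).trans (Finset.sum_le_sum fun p _ => ?_)
  have hs : ∀ σ : Equiv.Perm (Fin N), ‖((Equiv.Perm.sign σ : ℤ) : ℂ)‖ = 1 := by
    intro σ
    rcases Int.units_eq_one_or (Equiv.Perm.sign σ) with h | h <;> simp [h]
  rw [norm_mul, norm_mul, norm_star, norm_mul, norm_mul, hs, hs, hs, hs, norm_prod]
  simp

/-! ### The energy eigenbasis -/

/-- The Slater determinant of plane waves with momenta in `κ`. -/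
noncomputable def slaterState {L N : ℕ} (κ : Config L N) : Fock L :=
  slater fun i => planeWave (κ.enum i)

/-- The energy of the Slater determinant with momenta in `κ`. -/
noncomputable def configEnergy {L N : ℕ} (θ : ℝ) (κ : Config L N) : ℝ := ∑ k ∈ κ.1, bandEnergy θ k

theorem sum_bandEnergy_enum {L N : ℕ} (θ : ℝ) (κ : Config L N) :
    ∑ i, bandEnergy θ (κ.enum i) = configEnergy θ κ := by
  rw [configEnergy, ← κ.image_enum, Finset.sum_image κ.enum.injective.injOn]

theorem hamiltonian_slaterState {L N : ℕ} [NeZero L] (θ : ℝ) (κ : Config L N) :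
    hamiltonian L θ (slaterState κ) = (configEnergy θ κ : ℂ) • slaterState κ := by
  rw [slaterState, hamiltonian_slater_planeWave, sum_bandEnergy_enum]

theorem configEnergy_injective {L N : ℕ} (hL : Odd L) {θ : ℝ} (hnd : Nondegenerate L N θ) :
    Function.Injective (configEnergy (L := L) (N := N) θ) := fun κ κ' h =>
  Subtype.ext (sum_bandEnergy_injOn hL hnd κ.2 κ'.2 h)

theorem inner_eq_zero_of_hamiltonian_eigenvalue_ne {L : ℕ} {θ a b : ℝ} {ψ φ : Fock L}
    (hψ : hamiltonian L θ ψ = (a : ℂ) • ψ) (hφ : hamiltonian L θ φ = (b : ℂ) • φ) (hab : a ≠ b) :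
    inner ℂ ψ φ = (0 : ℂ) := by
  have h := inner_hamiltonian_left θ ψ φ
  rw [hψ, hφ, inner_smul_left, inner_smul_right, Complex.conj_ofReal] at h
  have h' : ((a : ℂ) - b) * inner ℂ ψ φ = 0 := by rw [sub_mul, h, sub_self]
  refine (mul_eq_zero.mp h').resolve_left ?_
  exact sub_ne_zero.mpr (by exact_mod_cast hab)

/-- Normalisation comes from the anticommutation relations. Orthogonality comes from nondegeneracy:
eigenvectors of a symmetric operator with different eigenvalues are orthogonal. -/
theorem orthonormal_slaterState {L N : ℕ} [NeZero L] (hL : Odd L) {θ : ℝ}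
    (hnd : Nondegenerate L N θ) : Orthonormal ℂ (slaterState (L := L) (N := N)) := by
  constructor
  · intro κ
    have h := inner_slater_self (fun i => planeWave (κ.enum i)) fun i j => by
      rw [sum_star_planeWave_mul]
      simp
    have h2 : ‖slaterState κ‖ ^ 2 = 1 := by
      have h3 := inner_self_eq_norm_sq (𝕜 := ℂ) (slaterState κ)
      rw [slaterState, h] at h3
      simpa [slaterState] using h3.symm
    exact (pow_eq_one_iff_of_nonneg (norm_nonneg _) two_ne_zero).mp h2
  · intro κ κ' h
    exact inner_eq_zero_of_hamiltonian_eigenvalue_ne (hamiltonian_slaterState θ κ)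
      (hamiltonian_slaterState θ κ') fun he => h (configEnergy_injective hL hnd he)

/-- The `N`-particle space has one coordinate for each configuration. -/
noncomputable def sectorEquiv (L N : ℕ) : sector L N ≃ₗ[ℂ] (Config L N → ℂ) where
  toFun ψ κ := (ψ : Fock L) κ.1
  map_add' _ _ := rfl
  map_smul' _ _ := rfl
  invFun f := ⟨WithLp.toLp 2 fun S => if h : S.card = N then f ⟨S, h⟩ else 0,
    fun S hS => by simp [hS]⟩
  left_inv ψ := by
    apply Subtype.ext
    ext S
    by_cases h : S.card = N
    · simp [h]
    · simp [h, ψ.2 S h]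
  right_inv f := by
    ext κ
    simp [κ.2]

theorem finrank_sector (L N : ℕ) : Module.finrank ℂ (sector L N) = L.choose N := by
  rw [(sectorEquiv L N).finrank_eq, Module.finrank_fintype_fun_eq_card, Config.card_eq]

theorem exists_slaterState_basis {L N : ℕ} [NeZero L] (hL : Odd L) {θ : ℝ}
    (hnd : Nondegenerate L N θ) :
    ∃ b : OrthonormalBasis (Config L N) ℂ (sector L N), ∀ κ, (b κ : Fock L) = slaterState κ := by
  let v : Config L N → sector L N := fun κ => ⟨slaterState κ, slater_mem_sector _⟩
  have hv : Orthonormal ℂ v := by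
    have h := orthonormal_slaterState (N := N) hL hnd
    exact ⟨fun κ => h.1 κ, fun κ κ' hne => h.2 hne⟩
  have hspan : ⊤ ≤ Submodule.span ℂ (Set.range v) := by
    rw [hv.linearIndependent.span_eq_top_of_card_eq_finrank'
      (by rw [finrank_sector, Config.card_eq])]
  refine ⟨OrthonormalBasis.mk hv hspan, fun κ => ?_⟩
  rw [OrthonormalBasis.coe_mk]

/-- Primality of L enters only through oddness, which places the shifted indices of `Fin L` in the
symmetric range `momentumIndices` and gives the left half just one site more than the right. -/
theorem odd_of_prime_of_le {N L : ℕ} (hN : N.Prime) (hLp : L.Prime)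
    (hL : 2 * erdosTuran N N - 1 ≤ L) : Odd L := by
  refine hLp.odd_of_ne_two ?_
  have h := lower_bound_chain_length hN hL
  have : 4 * 1 * 1 ≤ 4 * N * (N - 1) := by
    have := hN.two_le
    gcongr <;> omega
  omega

/-! ### Overlaps with the initial state and the effective dimension -/

/-- The Erdős–Turán sites as elements of `Fin L`. -/
def erdosTuranSite (L N : ℕ) [NeZero L] (j : Fin N) : Fin L := site L (erdosTuran N (j + 1))

theorem erdosTuranSite_val {N L : ℕ} [NeZero L] (hN : N.Prime)
    (hL : 2 * erdosTuran N N - 1 ≤ L) (j : Fin N) :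
    (erdosTuranSite L N j : ℕ) = erdosTuranPos N j := by
  have := two_mul_erdosTuranPos_lt hN hL j.2
  rw [erdosTuranSite, site, erdosTuran_succ, Nat.add_sub_cancel, Fin.val_ofNat]
  exact Nat.mod_eq_of_lt (by omega)

theorem erdosTuranSite_strictMono {N L : ℕ} [NeZero L] (hN : N.Prime)
    (hL : 2 * erdosTuran N N - 1 ≤ L) : StrictMono (erdosTuranSite L N) := by
  intro i j hij
  rw [Fin.lt_def, erdosTuranSite_val hN hL, erdosTuranSite_val hN hL]
  exact erdosTuranPos_strictMono hN.pos hij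

/-- The configuration of the initial state. -/
def initialConfig {N L : ℕ} [NeZero L] (hN : N.Prime) (hL : 2 * erdosTuran N N - 1 ≤ L) :
    Config L N :=
  ⟨Finset.univ.image (erdosTuranSite L N), by
    rw [Finset.card_image_of_injective _ (erdosTuranSite_strictMono hN hL).injective,
      Finset.card_univ, Fintype.card_fin]⟩

theorem initialConfig_enum {N L : ℕ} [NeZero L] (hN : N.Prime)
    (hL : 2 * erdosTuran N N - 1 ≤ L) (j : Fin N) :
    (initialConfig hN hL).enum j = erdosTuranSite L N j := by
  have h := Finset.orderEmbOfFin_unique (initialConfig hN hL).2 (f := erdosTuranSite L N)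
    (fun i => by simp [initialConfig]) (erdosTuranSite_strictMono hN hL)
  exact (congrFun h j).symm

theorem initialState_eq {N L : ℕ} [NeZero L] (hN : N.Prime)
    (hL : 2 * erdosTuran N N - 1 ≤ L) :
    initialState L N = EuclideanSpace.single (initialConfig hN hL).1 1 := by
  rw [initialState, initialConfig, ← slater_single (erdosTuranSite_strictMono hN hL)]
  exact prod_creation_vacuum (erdosTuranSite L N)

theorem norm_inner_initialState_slaterState {N L : ℕ} [NeZero L] (hN : N.Prime)
    (hL : 2 * erdosTuran N N - 1 ≤ L) (κ : Config L N) :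
    ‖inner ℂ (initialState L N) (slaterState κ)‖
      = ‖Matrix.det (Matrix.of fun i j => planeWave (κ.enum i) (erdosTuranSite L N j))‖ := by
  rw [initialState_eq hN hL, EuclideanSpace.inner_single_left, slaterState,
    slater_apply _ (initialConfig hN hL).2]
  simp only [map_one, one_mul]
  congr 3
  ext i j
  exact congrArg _ (initialConfig_enum hN hL j)

theorem norm_sum_planeWave_four (L : ℕ) [NeZero L] (a b c d : Fin L) :
    ‖∑ k : Fin L, planeWave k a * planeWave k b * star (planeWave k c * planeWave k d)‖
      = if (L : ℤ) ∣ (a : ℕ) + (b : ℕ) - (c : ℕ) - (d : ℕ) then (L : ℝ)⁻¹ else 0 := by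
  have hL : (0 : ℝ) < L := by exact_mod_cast NeZero.pos L
  have h : ∀ k : Fin L, planeWave k a * planeWave k b * star (planeWave k c * planeWave k d)
      = ((L : ℂ)⁻¹ * (L : ℂ)⁻¹) *
        rootExp L (momentumIndex k * ((a : ℕ) + (b : ℕ) - (c : ℕ) - (d : ℕ))) := by
    intro k
    have hs : (((Real.sqrt L)⁻¹ : ℝ) : ℂ) * (((Real.sqrt L)⁻¹ : ℝ) : ℂ) = (L : ℂ)⁻¹ := by
      rw [← Complex.ofReal_mul, ← mul_inv, Real.mul_self_sqrt hL.le]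
      simp
    have e : momentumIndex k * (((a : ℕ) : ℤ) + (b : ℕ) - (c : ℕ) - (d : ℕ))
        = momentumIndex k * (a : ℕ) + momentumIndex k * (b : ℕ) + -(momentumIndex k * (c : ℕ))
          + -(momentumIndex k * (d : ℕ)) := by ring
    rw [e, rootExp_add, rootExp_add, rootExp_add, rootExp_neg, rootExp_neg, ← hs]
    simp only [planeWave, star_mul', Complex.star_def, Complex.conj_ofReal]
    ring
  simp_rw [h]
  rw [← Finset.mul_sum, sum_rootExp_momentumIndex]
  split_ifs
  · rw [norm_mul, norm_mul, norm_inv, Complex.norm_natCast]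
    field_simp
  · simp

/-- The Sidon property kills every quadruple of permutations that does not match pointwise; the
others contribute L^{-N} each. One factor N! of their count cancels against the orderings of the
momenta. -/
theorem sum_overlap_pow_four_le {N L : ℕ} [NeZero L] (hN : N.Prime)
    (hL : 2 * erdosTuran N N - 1 ≤ L) :
    ∑ κ : Config L N, ‖inner ℂ (initialState L N) (slaterState κ)‖ ^ 4
      ≤ N.factorial * derangementSum N / (L : ℝ) ^ N := by
  have hNf : (0 : ℝ) < N.factorial := by exact_mod_cast N.factorial_pos
  have hL0 : (0 : ℝ) < L := by exact_mod_cast NeZero.pos L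
  simp_rw [norm_inner_initialState_slaterState hN hL]
  have h1 := factorial_mul_sum_config_le (L := L) (N := N) (fun k => ‖Matrix.det
    (Matrix.of fun i j => planeWave (k i) (erdosTuranSite L N j))‖ ^ 4)
    (fun k => by positivity) (fun k σ => by
      have : (Matrix.of fun i j => planeWave ((k ∘ σ) i) (erdosTuranSite L N j))
          = (Matrix.of fun i j => planeWave (k i) (erdosTuranSite L N j)).submatrix σ id := rfl
      rw [this, Matrix.det_permute, norm_mul]
      rcases Int.units_eq_one_or (Equiv.Perm.sign σ) with h | h <;> simp [h])
  have h2 := sum_norm_det_pow_four_le (fun k j => planeWave k (erdosTuranSite L N j))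
  have h3 : ∀ p : (Equiv.Perm (Fin N) × Equiv.Perm (Fin N)) ×
          (Equiv.Perm (Fin N) × Equiv.Perm (Fin N)),
      ∏ i, ‖∑ x : Fin L, planeWave x (erdosTuranSite L N (p.1.1 i))
        * planeWave x (erdosTuranSite L N (p.1.2 i))
        * star (planeWave x (erdosTuranSite L N (p.2.1 i))
          * planeWave x (erdosTuranSite L N (p.2.2 i)))‖
      ≤ if ∀ i, (p.2.1 i = p.1.1 i ∧ p.2.2 i = p.1.2 i) ∨
          (p.2.1 i = p.1.2 i ∧ p.2.2 i = p.1.1 i) then ((L : ℝ) ^ N)⁻¹ else 0 := by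
    intro p
    simp_rw [norm_sum_planeWave_four, erdosTuranSite_val hN hL]
    split_ifs with hp
    · rw [← inv_pow]
      refine (Finset.prod_le_prod (g := fun _ => (L : ℝ)⁻¹) (fun i _ => ?_)
        fun i _ => ?_).trans_eq (by simp)
      all_goals split_ifs
      any_goals exact le_rfl
      all_goals positivity
    · push Not at hp
      obtain ⟨i, hi1, hi2⟩ := hp
      refine (Finset.prod_eq_zero (Finset.mem_univ i) ?_).le
      rw [if_neg]
      intro hd
      rcases erdosTuranPos_sidon hN hL (p.1.1 i).2 (p.1.2 i).2 (p.2.1 i).2 (p.2.2 i).2 hd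
        with h | h
      · exact hi1 (Fin.ext h.1.symm) (Fin.ext h.2.symm)
      · exact hi2 (Fin.ext h.2.symm) (Fin.ext h.1.symm)
  have h4 := card_matching_perm_quadruples_le N
  have h5 := h1.trans (h2.trans (Finset.sum_le_sum fun p _ => h3 p))
  rw [← Finset.sum_filter, Finset.sum_const, nsmul_eq_mul] at h5
  have h6 := h5.trans (mul_le_mul_of_nonneg_right h4 (by positivity))
  rw [mul_assoc] at h6
  have h7 := le_of_mul_le_mul_left h6 hNf
  rwa [← div_eq_mul_inv] at h7

theorem choose_mul_sum_overlap_le {N L : ℕ} [NeZero L] (hN : N.Prime)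
    (hL : 2 * erdosTuran N N - 1 ≤ L) :
    (L.choose N : ℝ) * ∑ κ : Config L N, ‖inner ℂ (initialState L N) (slaterState κ)‖ ^ 4
      ≤ ((N : ℝ) + 2 * Real.exp 1 - 3) / Real.exp 1 := by
  refine le_trans ?_ (derangementSum_le hN.two_le)
  have hNf : (0 : ℝ) < N.factorial := by exact_mod_cast N.factorial_pos
  have hL0 : (0 : ℝ) < L := by exact_mod_cast NeZero.pos L
  have hd : 0 ≤ derangementSum N := Finset.sum_nonneg fun _ _ => by positivity
  refine (mul_le_mul (Nat.choose_le_pow_div N L) (sum_overlap_pow_four_le hN hL)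
    (Finset.sum_nonneg fun _ _ => by positivity) (by positivity)).trans_eq ?_
  field_simp

/-- Each Ψ_j overlaps some Slater determinant, shares its energy, and is therefore orthogonal to all
the others: it is that determinant times a phase. Distinct j use distinct determinants, so the
fourth moment for Ψ is at most that of the Slater basis. -/
theorem effectiveDimension_bound {N L : ℕ} [NeZero L] {θ : ℝ} (hN : N.Prime) (hLp : L.Prime)
    (hL : 2 * erdosTuran N N - 1 ≤ L) (hnd : Nondegenerate L N θ)
    (Ψ : OrthonormalBasis (Fin (Module.finrank ℂ (sector L N))) ℂ (sector L N))
    (hΨ : IsEnergyEigenbasis θ Ψ) :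
    (Module.finrank ℂ (sector L N) : ℝ) / effectiveDimension Ψ (initialState L N)
      ≤ ((N : ℝ) + 2 * Real.exp 1 - 3) / Real.exp 1 := by
  have hodd := odd_of_prime_of_le hN hLp hL
  obtain ⟨b, hb⟩ := exists_slaterState_basis (N := N) hodd hnd
  have h1 : ∀ j, ∃ κ : Config L N, ∃ c : ℂ, Ψ j = c • b κ := by
    intro j
    obtain ⟨E, hE⟩ := hΨ j
    obtain ⟨κ, hκ⟩ : ∃ κ, inner ℂ (b κ) (Ψ j) ≠ (0 : ℂ) := by
      by_contra! h
      have := b.sum_repr' (Ψ j)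
      simp only [h, zero_smul, Finset.sum_const_zero] at this
      exact Ψ.toBasis.ne_zero j (by simpa using this.symm)
    have hEκ : configEnergy θ κ = E := by
      by_contra hne
      refine hκ ?_
      rw [Submodule.coe_inner, hb]
      exact inner_eq_zero_of_hamiltonian_eigenvalue_ne (hamiltonian_slaterState θ κ) hE hne
    refine ⟨κ, inner ℂ (b κ) (Ψ j), ?_⟩
    conv_lhs => rw [← b.sum_repr' (Ψ j)]
    refine Finset.sum_eq_single κ (fun κ' _ hne => ?_) fun h => absurd (Finset.mem_univ _) h
    have : inner ℂ (b κ') (Ψ j) = (0 : ℂ) := by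
      rw [Submodule.coe_inner, hb]
      refine inner_eq_zero_of_hamiltonian_eigenvalue_ne (hamiltonian_slaterState θ κ') hE ?_
      rw [← hEκ]
      exact fun h => hne (configEnergy_injective hodd hnd h)
    rw [this, zero_smul]
  choose κ c hc using h1
  have hcn : ∀ j, ‖c j‖ = 1 := by
    intro j
    have := Ψ.norm_eq_one j
    rwa [hc, norm_smul, b.norm_eq_one, mul_one] at this
  have hinj : Function.Injective κ := by
    intro j j' h
    by_contra hne
    have h2 : inner ℂ (Ψ j : Fock L) (Ψ j' : Fock L) = (0 : ℂ) := Ψ.inner_eq_zero hne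
    have h4 : inner ℂ (b (κ j') : Fock L) (b (κ j') : Fock L) = (1 : ℂ) := b.inner_eq_one _
    rw [hc j, hc j', h, Submodule.coe_smul, Submodule.coe_smul, inner_smul_left,
      inner_smul_right, h4, mul_one] at h2
    rcases mul_eq_zero.mp h2 with h3 | h3
    · have := hcn j
      rw [← RCLike.norm_conj, h3] at this
      simp at this
    · have := hcn j'
      rw [h3] at this
      simp at this
  have hsum : ∑ j, ‖inner ℂ (initialState L N) (Ψ j : Fock L)‖ ^ 4
      ≤ ∑ κ : Config L N, ‖inner ℂ (initialState L N) (slaterState κ)‖ ^ 4 := by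
    have h3 : ∀ j, ‖inner ℂ (initialState L N) (Ψ j : Fock L)‖ ^ 4
        = ‖inner ℂ (initialState L N) (slaterState (κ j))‖ ^ 4 := by
      intro j
      rw [hc j, Submodule.coe_smul, inner_smul_right, norm_mul, hcn, one_mul, hb]
    simp_rw [h3]
    rw [← Finset.sum_image (f := fun κ : Config L N =>
      ‖inner ℂ (initialState L N) (slaterState κ)‖ ^ 4) hinj.injOn]
    exact Finset.sum_le_sum_of_subset_of_nonneg (Finset.subset_univ _)
      fun _ _ _ => by positivity
  have hrank : (Module.finrank ℂ (sector L N) : ℝ) = L.choose N := by rw [finrank_sector]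
  rw [effectiveDimension, div_inv_eq_mul, hrank]
  exact (mul_le_mul_of_nonneg_left hsum (by positivity)).trans (choose_mul_sum_overlap_le hN hL)

/-! ### Large deviations of the number of particles on the left -/

/-- The number of particles of an occupation set in the left half of the chain. -/
def leftCount {L : ℕ} (S : Finset (Fin L)) : ℕ :=
  (S.filter fun x : Fin L => x.val + 1 ≤ (L + 1) / 2).card

/-- `1/2` on the left half of the chain and `-1/2` on the right half. -/
noncomputable def sideSign {L : ℕ} (x : Fin L) : ℝ :=
  if x.val + 1 ≤ (L + 1) / 2 then 1 / 2 else -(1 / 2)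

theorem sum_sideSign_enum {L N : ℕ} (κ : Config L N) :
    ∑ i, sideSign (κ.enum i) = leftCount κ.1 - (N : ℝ) / 2 := by
  have h : ∑ i, sideSign (κ.enum i) = ∑ x ∈ κ.1, sideSign x := by
    conv_rhs => rw [← κ.image_enum, Finset.sum_image κ.enum.injective.injOn]
  have h2 : ∀ x : Fin L, sideSign x
      = (if x.val + 1 ≤ (L + 1) / 2 then 1 else 0) - 1 / 2 := by
    intro x
    rw [sideSign]
    split_ifs <;> norm_num
  rw [h]
  simp_rw [h2]
  rw [Finset.sum_sub_distrib, Finset.sum_boole, Finset.sum_const, κ.2, leftCount]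
  simp
  ring

theorem card_left (L : ℕ) :
    (Finset.univ.filter fun x : Fin L => x.val + 1 ≤ (L + 1) / 2).card = (L + 1) / 2 := by
  have h : (Finset.univ.filter fun x : Fin L => x.val + 1 ≤ (L + 1) / 2).map Fin.valEmbedding
      = Finset.range ((L + 1) / 2) := by
    ext n
    simp only [Finset.mem_map, Finset.mem_filter, Finset.mem_univ, true_and,
      Fin.valEmbedding_apply, Finset.mem_range]
    constructor
    · rintro ⟨x, hx, rfl⟩
      omega
    · intro hn
      exact ⟨⟨n, by omega⟩, by simpa using hn, rfl⟩
  rw [← Finset.card_map Fin.valEmbedding, h, Finset.card_range]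

/-- For L = 2m + 1 the halves have m + 1 and m sites. Adding one fictitious site on the right
symmetrises the sum to (L + 1) cosh(a/2), and cosh x ≤ e^{x²/2}. -/
theorem sum_exp_sideSign_le {L : ℕ} (hL : Odd L) (a : ℝ) :
    ∑ x : Fin L, Real.exp (a * sideSign x) ≤ (L + 1) * Real.exp (a ^ 2 / 8) := by
  have h : ∀ x : Fin L, Real.exp (a * sideSign x) = Real.exp (-(a / 2))
      + (Real.exp (a / 2) - Real.exp (-(a / 2)))
        * (if x.val + 1 ≤ (L + 1) / 2 then 1 else 0) := by
    intro x
    rw [sideSign]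
    split_ifs <;> ring_nf
  simp_rw [h]
  rw [Finset.sum_add_distrib, ← Finset.mul_sum, Finset.sum_boole, card_left, Finset.sum_const,
    Finset.card_univ, Fintype.card_fin, nsmul_eq_mul]
  obtain ⟨m, rfl⟩ := hL
  have hm : (2 * m + 1 + 1) / 2 = m + 1 := by omega
  rw [hm]
  have hc := Real.cosh_le_exp_half_sq (a / 2)
  have e : (a / 2) ^ 2 / 2 = a ^ 2 / 8 := by ring
  rw [e, Real.cosh_eq] at hc
  push_cast
  have h1 := Real.exp_pos (-(a / 2))
  have hm0 : (0 : ℝ) ≤ 2 * m + 1 + 1 := by positivity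
  nlinarith [mul_le_mul_of_nonneg_left hc hm0]

/-- Exponential Markov inequality for ordered tuples of independent sites; passing to configurations
divides by N! and drops the exclusion constraint. -/
theorem card_config_tail_le {L N : ℕ} (hL : Odd L) {ε : ℝ} (a : ℝ) :
    ((Finset.univ.filter fun κ : Config L N =>
        4 * ε ^ 2 * N < a * (leftCount κ.1 - (N : ℝ) / 2)).card : ℝ)
      ≤ (L + 1) ^ N * Real.exp (a ^ 2 / 8 * N - 4 * ε ^ 2 * N) / N.factorial := by
  have hNf : (0 : ℝ) < N.factorial := by exact_mod_cast N.factorial_pos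
  have h1 := factorial_mul_sum_config_le (L := L) (N := N)
    (fun k => ∏ i, Real.exp (a * sideSign (k i)))
    (fun k => Finset.prod_nonneg fun _ _ => (Real.exp_pos _).le)
    (fun k σ => Equiv.prod_comp σ fun i => Real.exp (a * sideSign (k i)))
  have h2 : ∑ k : Fin N → Fin L, ∏ i, Real.exp (a * sideSign (k i))
      ≤ ((L + 1) * Real.exp (a ^ 2 / 8)) ^ N := by
    have := Finset.prod_univ_sum (fun _ : Fin N => (Finset.univ : Finset (Fin L)))
      (fun _ x => Real.exp (a * sideSign x))
    rw [Fintype.piFinset_univ] at this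
    rw [← this, Finset.prod_const, Finset.card_univ, Fintype.card_fin]
    exact pow_le_pow_left₀ (Finset.sum_nonneg fun _ _ => (Real.exp_pos _).le)
      (sum_exp_sideSign_le hL a) N
  have h3 : ((Finset.univ.filter fun κ : Config L N =>
        4 * ε ^ 2 * N < a * (leftCount κ.1 - (N : ℝ) / 2)).card : ℝ) * Real.exp (4 * ε ^ 2 * N)
      ≤ ∑ κ : Config L N, ∏ i, Real.exp (a * sideSign (κ.enum i)) := by
    rw [← nsmul_eq_mul, ← Finset.sum_const]
    refine (Finset.sum_le_sum fun κ hκ => ?_).trans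
      (Finset.sum_le_sum_of_subset_of_nonneg (Finset.filter_subset _ _)
        fun _ _ _ => Finset.prod_nonneg fun _ _ => (Real.exp_pos _).le)
    rw [← Real.exp_sum, ← Finset.mul_sum, sum_sideSign_enum]
    exact Real.exp_le_exp.mpr (Finset.mem_filter.mp hκ).2.le
  have h4 := (mul_le_mul_of_nonneg_left h3 hNf.le).trans (h1.trans h2)
  rw [le_div_iff₀ hNf, Real.exp_sub, mul_div_assoc', le_div_iff₀ (Real.exp_pos _)]
  rw [mul_pow, ← Real.exp_nat_mul, mul_comm (N : ℝ)] at h4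
  linarith

/-- The configurations whose fraction of particles on the left differs from `1/2` by more
than `ε`. -/
noncomputable def unbalanced (L N : ℕ) (ε : ℝ) : Finset (Config L N) :=
  Finset.univ.filter fun κ => ε < |(leftCount κ.1 : ℝ) / N - 1 / 2|

theorem card_unbalanced_le {L N : ℕ} (hN : 0 < N) (hL : Odd L) {ε : ℝ} (hε : 0 < ε) :
    ((unbalanced L N ε).card : ℝ)
      ≤ 2 * ((L + 1) ^ N * Real.exp (-(2 * ε ^ 2 * N)) / N.factorial) := by
  have hN' : (0 : ℝ) < N := by exact_mod_cast hN
  -- The value a = 4ε minimises a²/8 - aε, and the minimum is -2ε²; the opposite sign handles the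
  -- other tail.
  have h1 := card_config_tail_le (N := N) hL (ε := ε) (4 * ε)
  have h2 := card_config_tail_le (N := N) hL (ε := ε) (-(4 * ε))
  have e1 : (4 * ε) ^ 2 / 8 * N - 4 * ε ^ 2 * N = -(2 * ε ^ 2 * N) := by ring
  have e2 : (-(4 * ε)) ^ 2 / 8 * N - 4 * ε ^ 2 * N = -(2 * ε ^ 2 * N) := by ring
  rw [e1] at h1
  rw [e2] at h2
  have hsub : unbalanced L N ε ⊆ (Finset.univ.filter fun κ : Config L N =>
        4 * ε ^ 2 * N < 4 * ε * (leftCount κ.1 - (N : ℝ) / 2)) ∪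
      (Finset.univ.filter fun κ : Config L N =>
        4 * ε ^ 2 * N < -(4 * ε) * (leftCount κ.1 - (N : ℝ) / 2)) := by
    intro κ hκ
    simp only [unbalanced, Finset.mem_filter, Finset.mem_univ, true_and] at hκ
    simp only [Finset.mem_union, Finset.mem_filter, Finset.mem_univ, true_and]
    have e : (leftCount κ.1 : ℝ) - N / 2 = N * ((leftCount κ.1 : ℝ) / N - 1 / 2) := by
      field_simp
    rw [e]
    have hp : 0 < 4 * ε * N := by positivity
    rcases lt_abs.mp hκ with h | h
    · left
      nlinarith [mul_lt_mul_of_pos_left h hp]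
    · right
      nlinarith [mul_lt_mul_of_pos_left h hp]
  have h3 : ((unbalanced L N ε).card : ℝ) ≤ _ :=
    Nat.cast_le.mpr ((Finset.card_le_card hsub).trans (Finset.card_union_le _ _))
  push_cast at h3
  linarith

/-- The factorials cancel, and the powers of L leave (1 + 1/L)^N ≤ e^{N/L} ≤ 3. The factor 6 is this
3 times the two tails, and N + 2 bounds the derangement sum. -/
theorem card_unbalanced_mul_sum_overlap_le {N L : ℕ} [NeZero L] (hN : N.Prime) (hLp : L.Prime)
    (hL : 2 * erdosTuran N N - 1 ≤ L) {ε : ℝ} (hε : 0 < ε) :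
    ((unbalanced L N ε).card : ℝ)
        * ∑ κ : Config L N, ‖inner ℂ (initialState L N) (slaterState κ)‖ ^ 4
      ≤ 6 * (N + 2) * Real.exp (-(2 * ε ^ 2 * N)) := by
  have hNf : (0 : ℝ) < N.factorial := by exact_mod_cast N.factorial_pos
  have hL0 : (0 : ℝ) < L := by exact_mod_cast NeZero.pos L
  have hNL : N ≤ L := by
    have h := lower_bound_chain_length hN hL
    have h2 := hN.two_le
    have : N * 1 ≤ 4 * N * (N - 1) := by gcongr <;> omega
    omega
  have hd0 : 0 ≤ derangementSum N := Finset.sum_nonneg fun _ _ => by positivity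
  have hd : derangementSum N ≤ N + 2 := by
    refine (derangementSum_le hN.two_le).trans ?_
    have he := Real.add_one_le_exp 1
    rw [div_le_iff₀ (Real.exp_pos 1)]
    have hN0 : (0 : ℝ) ≤ N := by positivity
    nlinarith
  have h1 := mul_le_mul (card_unbalanced_le hN.pos (odd_of_prime_of_le hN hLp hL) hε)
    (sum_overlap_pow_four_le hN hL) (Finset.sum_nonneg fun _ _ => by positivity) (by positivity)
  refine h1.trans ?_
  have h2 : ((L : ℝ) + 1) ^ N / (L : ℝ) ^ N ≤ 3 := by
    rw [← div_pow, add_div, div_self hL0.ne', add_comm]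
    calc (1 / (L : ℝ) + 1) ^ N ≤ Real.exp (1 / L) ^ N := by
          gcongr
          exact Real.add_one_le_exp _
      _ = Real.exp (N / L) := by rw [← Real.exp_nat_mul]; ring_nf
      _ ≤ Real.exp 1 := by
          gcongr
          rw [div_le_one hL0]
          exact_mod_cast hNL
      _ ≤ 3 := by linarith [Real.exp_one_lt_d9]
  have e : 2 * (((L : ℝ) + 1) ^ N * Real.exp (-(2 * ε ^ 2 * N)) / N.factorial)
      * (N.factorial * derangementSum N / (L : ℝ) ^ N)
      = 2 * (((L : ℝ) + 1) ^ N / (L : ℝ) ^ N) * derangementSum N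
        * Real.exp (-(2 * ε ^ 2 * N)) := by
    field_simp
  rw [e]
  gcongr
  nlinarith

/-! ### Time evolution and the Born rule -/

open MeasureTheory

theorem exp_apply_of_eigenvector {E : Type*} [NormedAddCommGroup E] [NormedSpace ℂ E]
    [CompleteSpace E] (A : E →L[ℂ] E) {v : E} {c : ℂ} (h : A v = c • v) :
    NormedSpace.exp A v = Complex.exp c • v := by
  have hpow : ∀ n : ℕ, (A ^ n) v = c ^ n • v := by
    intro n
    induction n with
    | zero => simp
    | succ n ih => rw [pow_succ, mul_apply_eq_comp, h, map_smul, ih, smul_smul, pow_succ, mul_comm]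
  have h1 := (NormedSpace.exp_series_hasSum_exp' (𝕂 := ℂ) A).mapL
    (ContinuousLinearMap.apply ℂ E v)
  have h2 := (NormedSpace.exp_series_hasSum_exp' (𝕂 := ℂ) c).smul_const v
  rw [← Complex.exp_eq_exp_ℂ] at h2
  have e : (fun n : ℕ => ContinuousLinearMap.apply ℂ E v (((n.factorial : ℂ)⁻¹) • A ^ n))
      = fun n : ℕ => (((n.factorial : ℂ)⁻¹) • c ^ n) • v := by
    funext n
    rw [map_smul, ContinuousLinearMap.apply_apply, hpow, smul_assoc]
  rw [e] at h1
  exact h1.unique h2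

theorem evolve_slaterState {L N : ℕ} [NeZero L] (θ t : ℝ) (κ : Config L N) :
    evolve L θ t (slaterState κ)
      = Complex.exp (-(Complex.I * (configEnergy θ κ * t : ℝ))) • slaterState κ := by
  rw [evolve, exp_apply_of_eigenvector _ (c := -(Complex.I * (configEnergy θ κ * t : ℝ)))]
  rw [smul_apply, hamiltonian_slaterState, smul_smul]
  congr 1
  push_cast
  ring

theorem numberLeft_apply {L : ℕ} (ψ : Fock L) (S : Finset (Fin L)) :
    numberLeft L ψ S = leftCount S * ψ S := by
  have h : ∀ x : Fin L, numberAt x ψ S = (if x ∈ S then 1 else 0) * ψ S := by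
    intro x
    rw [numberAt, mul_apply_eq_comp, creation_apply, annihilation_apply]
    by_cases hx : x ∈ S
    · simp [hx, Finset.insert_erase hx, jwSign_erase x hx, ← mul_assoc, jwSign_mul_self]
    · simp [hx]
  rw [numberLeft, sum_apply]
  simp only [WithLp.ofLp_sum, Finset.sum_apply, h]
  rw [← Finset.sum_mul, Finset.sum_boole, leftCount, Finset.filter_filter]
  congr 3
  ext x
  simp [and_comm]

/-- The truncation Ψ of Φ to G lies in the range of the projection P, and ⟨Ψ, PΦ⟩ = ⟨Ψ, Φ⟩ = ‖Ψ‖².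
Cauchy–Schwarz gives ‖Ψ‖ ≤ ‖PΦ‖. -/
theorem sum_norm_sq_le_measurementProb {L : ℕ} (Φ : Fock L) (B : Set ℝ)
    (G : Finset (Finset (Fin L))) (hG : ∀ S ∈ G, (leftCount S : ℝ) ∈ B) :
    ∑ S ∈ G, ‖Φ S‖ ^ 2 ≤ measurementProb (numberLeft L) Φ B := by
  rw [measurementProb]
  set W : Submodule ℂ (Fock L) :=
    ⨆ a ∈ B, Module.End.eigenspace (numberLeft L : Fock L →ₗ[ℂ] Fock L) (a : ℂ) with hW
  set Ψ : Fock L := WithLp.toLp 2 fun S => if S ∈ G then Φ S else 0 with hΨ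
  have hmem : Ψ ∈ W := by
    have e : Ψ = ∑ S ∈ G, Φ S • EuclideanSpace.single S (1 : ℂ) := by
      ext S
      simp [hΨ, Pi.single_apply]
    rw [e]
    refine Submodule.sum_mem _ fun S hS => Submodule.smul_mem _ _ ?_
    refine Submodule.mem_iSup_of_mem (leftCount S : ℝ)
      (Submodule.mem_iSup_of_mem (hG S hS) ?_)
    rw [Module.End.mem_eigenspace_iff]
    ext T
    rw [ContinuousLinearMap.coe_coe, numberLeft_apply]
    by_cases hT : T = S
    · simp [hT]
    · simp [hT]
  have hnorm : ‖Ψ‖ ^ 2 = ∑ S ∈ G, ‖Φ S‖ ^ 2 := by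
    rw [EuclideanSpace.norm_sq_eq, ← Finset.sum_filter_add_sum_filter_not _ (· ∈ G)]
    rw [Finset.sum_eq_zero (s := Finset.univ.filter (· ∉ G)), add_zero]
    · rw [Finset.filter_mem_eq_inter, Finset.univ_inter]
      exact Finset.sum_congr rfl fun S hS => by simp [hΨ, hS]
    · intro S hS
      simp [hΨ, (Finset.mem_filter.mp hS).2]
  have hinner : inner ℂ Ψ Φ = inner ℂ Ψ Ψ := by
    rw [PiLp.inner_apply, PiLp.inner_apply]
    refine Finset.sum_congr rfl fun S _ => ?_
    by_cases hS : S ∈ G <;> simp [hΨ, hS]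
  have h1 : inner ℂ Ψ (W.starProjection Φ) = inner ℂ Ψ Ψ := by
    rw [← Submodule.inner_starProjection_left_eq_right,
      Submodule.starProjection_eq_self_iff.mpr hmem, hinner]
  have h2 : ‖Ψ‖ ^ 2 ≤ ‖Ψ‖ * ‖W.starProjection Φ‖ := by
    have h3 := norm_inner_le_norm (𝕜 := ℂ) Ψ (W.starProjection Φ)
    rw [h1, inner_self_eq_norm_sq_to_K, norm_pow, RCLike.norm_ofReal, abs_norm] at h3
    exact h3
  rw [← hnorm]
  have h4 : ‖Ψ‖ ≤ ‖W.starProjection Φ‖ := by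
    rcases (norm_nonneg Ψ).eq_or_lt with h | h
    · rw [← h]; exact norm_nonneg _
    · rw [sq] at h2
      exact le_of_mul_le_mul_left h2 h
  gcongr

theorem one_sub_le_measurementProb {L N : ℕ} {Φ : Fock L} (hΦ : Φ ∈ sector L N) (hn : ‖Φ‖ = 1)
    (ε : ℝ) :
    1 - ∑ κ ∈ unbalanced L N ε, ‖Φ κ.1‖ ^ 2
      ≤ measurementProb (numberLeft L) Φ {m : ℝ | |m / N - 1 / 2| ≤ ε} := by
  refine le_trans ?_ (sum_norm_sq_le_measurementProb Φ _
    ((Finset.univ.filter fun κ : Config L N => ¬ ε < |(leftCount κ.1 : ℝ) / N - 1 / 2|).map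
      (Function.Embedding.subtype _)) ?_)
  · rw [Finset.sum_map, sub_le_iff_le_add, unbalanced]
    simp only [Function.Embedding.subtype_apply]
    rw [add_comm, Finset.sum_filter_add_sum_filter_not Finset.univ
      (fun κ : Config L N => ε < |(leftCount κ.1 : ℝ) / N - 1 / 2|) fun κ => ‖Φ κ.1‖ ^ 2]
    have h1 : ‖Φ‖ ^ 2 = 1 := by rw [hn, one_pow]
    rw [EuclideanSpace.norm_sq_eq] at h1
    rw [← h1, ← Finset.sum_subtype (Finset.univ.filter fun S : Finset (Fin L) => S.card = N)
      (by simp) fun S => ‖Φ S‖ ^ 2]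
    refine (Finset.sum_subset (Finset.filter_subset _ _) fun S _ hS => ?_).ge
    rw [hΦ S (by simpa using hS)]
    simp
  · intro S hS
    obtain ⟨κ, hκ, rfl⟩ := Finset.mem_map.mp hS
    exact not_lt.mp (Finset.mem_filter.mp hκ).2

/-! ### Time averages and good times -/

/-- Diagonal terms grow linearly in T, while each oscillating term has an integral bounded
independently of T. Distinct frequencies suffice; coinciding gaps do no harm. -/
theorem exists_integral_norm_sq_trigSum_le {ι : Type*} [Fintype ι] {E : ι → ℝ}
    (hE : Function.Injective E) (a : ι → ℂ) :
    ∃ C, ∀ T, 0 < T →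
      ∫ t in (0 : ℝ)..T, ‖∑ i, a i * Complex.exp (-(Complex.I * (E i * t : ℝ)))‖ ^ 2
        ≤ T * ∑ i, ‖a i‖ ^ 2 + C := by
  classical
  -- The summands with i = j vanish, since 2 / 0 = 0.
  refine ⟨∑ i, ∑ j, ‖a i‖ * ‖a j‖ * (2 / |E j - E i|), fun T hT => ?_⟩
  have hexp : ∀ t : ℝ, ((‖∑ i, a i * Complex.exp (-(Complex.I * (E i * t : ℝ)))‖ ^ 2 : ℝ) : ℂ)
      = ∑ i, ∑ j, (a i * star (a j)) * Complex.exp ((Complex.I * (E j - E i : ℝ)) * t) := by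
    intro t
    rw [Complex.ofReal_pow, ← Complex.mul_conj', map_sum, Finset.sum_mul_sum]
    refine Finset.sum_congr rfl fun i _ => Finset.sum_congr rfl fun j _ => ?_
    have e : (Complex.I * (E j - E i : ℝ)) * t
        = -(Complex.I * (E i * t : ℝ)) + Complex.I * (E j * t : ℝ) := by
      push_cast; ring
    rw [map_mul, ← Complex.exp_conj, e, Complex.exp_add, Complex.star_def]
    simp only [map_neg, map_mul, Complex.conj_I, Complex.conj_ofReal]
    ring_nf
  have hint : ((∫ t in (0 : ℝ)..T,
        ‖∑ i, a i * Complex.exp (-(Complex.I * (E i * t : ℝ)))‖ ^ 2 : ℝ) : ℂ)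
      = ∑ i, ∑ j, (a i * star (a j)) *
        ∫ t in (0 : ℝ)..T, Complex.exp ((Complex.I * (E j - E i : ℝ)) * t) := by
    rw [← intervalIntegral.integral_ofReal]
    simp_rw [hexp]
    have hc : ∀ i j, IntervalIntegrable (fun t : ℝ => (a i * star (a j))
        * Complex.exp ((Complex.I * (E j - E i : ℝ)) * t)) volume 0 T := fun i j =>
      (by fun_prop : Continuous _).intervalIntegrable _ _
    rw [intervalIntegral.integral_finsetSum
      fun i _ => (by fun_prop : Continuous _).intervalIntegrable _ _]
    refine Finset.sum_congr rfl fun i _ => ?_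
    rw [intervalIntegral.integral_finsetSum fun j _ => hc i j]
    refine Finset.sum_congr rfl fun j _ => ?_
    rw [intervalIntegral.integral_const_mul]
  have hterm : ∀ i j, ‖(a i * star (a j)) *
        ∫ t in (0 : ℝ)..T, Complex.exp ((Complex.I * (E j - E i : ℝ)) * t)‖
      ≤ (if i = j then T * ‖a i‖ ^ 2 else 0) + ‖a i‖ * ‖a j‖ * (2 / |E j - E i|) := by
    intro i j
    rw [norm_mul, norm_mul, norm_star]
    by_cases hij : i = j
    · subst hij
      simp [abs_of_pos hT]
      exact (by ring : _ = _).le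
    · have hne : E j - E i ≠ 0 := sub_ne_zero.mpr fun h => hij (hE h).symm
      have hc : Complex.I * (E j - E i : ℝ) ≠ 0 :=
        mul_ne_zero Complex.I_ne_zero (by exact_mod_cast hne)
      rw [if_neg hij, zero_add, integral_exp_mul_complex hc, norm_div, norm_mul, Complex.norm_I,
        one_mul, Complex.norm_real, Real.norm_eq_abs]
      gcongr
      refine (norm_sub_le _ _).trans ?_
      have hn : ∀ s : ℝ, ‖Complex.exp (Complex.I * (E j - E i : ℝ) * s)‖ = 1 := by
        intro s
        rw [mul_assoc, ← Complex.ofReal_mul, mul_comm, Complex.norm_exp_ofReal_mul_I]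
      rw [hn, hn]
      norm_num
  have h0 : 0 ≤ ∫ t in (0 : ℝ)..T, ‖∑ i, a i * Complex.exp (-(Complex.I * (E i * t : ℝ)))‖ ^ 2 :=
    intervalIntegral.integral_nonneg hT.le fun _ _ => by positivity
  rw [← abs_of_nonneg h0, ← Real.norm_eq_abs, ← Complex.norm_real, hint]
  refine (norm_sum_le _ _).trans ((Finset.sum_le_sum fun i _ => (norm_sum_le _ _).trans
    (Finset.sum_le_sum fun j _ => hterm i j)).trans_eq ?_)
  simp_rw [Finset.sum_add_distrib]
  simp [Finset.mul_sum]

/-- Markov's inequality is applied at level δ/2 rather than δ: the compact set where w ≤ δ/2 is then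
covered by finitely many intervals on which w < δ. This is the source of the factor 2. -/
theorem exists_union_of_intervals_of_integral_le {w : ℝ → ℝ} (hw : Continuous w)
    (hw0 : ∀ t, 0 ≤ w t) {δ T B : ℝ} (hδ : 0 < δ) (hT : 0 < T)
    (hB : ∫ t in (0 : ℝ)..T, w t ≤ T * B) :
    ∃ G : Set ℝ, G ⊆ Set.Icc 0 T ∧ IsUnionOfIntervals G ∧
      1 - 2 * B / δ ≤ volume.real G / T ∧ ∀ t ∈ G, w t < δ := by
  have hK : IsCompact (Set.Icc 0 T ∩ {t | w t ≤ δ / 2}) :=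
    isCompact_Icc.inter_right (isClosed_le hw continuous_const)
  have hr : ∀ t : ℝ, ∃ r > 0, w t ≤ δ / 2 → ∀ s ∈ Metric.ball t r, w s < δ := by
    intro t
    by_cases h : w t ≤ δ / 2
    · obtain ⟨r, hr, hs⟩ := Metric.isOpen_iff.mp (isOpen_lt hw continuous_const) t
        (show w t < δ by linarith)
      exact ⟨r, hr, fun _ s hs' => hs hs'⟩
    · exact ⟨1, one_pos, fun h' => absurd h' h⟩
  choose r hr0 hr using hr
  obtain ⟨F, hF, hcover⟩ := hK.elim_nhds_subcover (fun t => Metric.ball t (r t))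
    fun t _ => Metric.ball_mem_nhds t (hr0 t)
  set G : Set ℝ := ⋃₀ ((fun t => Metric.ball t (r t) ∩ Set.Icc 0 T) '' (F : Set ℝ)) with hG
  have hGI : G ⊆ Set.Icc 0 T := by
    rintro s ⟨I, ⟨t, -, rfl⟩, hs⟩
    exact hs.2
  refine ⟨G, hGI, ⟨_, F.finite_toSet.image _, ?_, rfl⟩, ?_, ?_⟩
  · rintro I ⟨t, -, rfl⟩
    simp only [Real.ball_eq_Ioo]
    exact Set.ordConnected_Ioo.inter Set.ordConnected_Icc
  · have hKG : Set.Icc 0 T ∩ {t | w t ≤ δ / 2} ⊆ G := by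
      intro s hs
      obtain ⟨t, ht, hst⟩ := Set.mem_iUnion₂.mp (hcover hs)
      exact ⟨_, ⟨t, ht, rfl⟩, hst, hs.1⟩
    have hint : Integrable w (volume.restrict (Set.Icc 0 T)) :=
      hw.continuousOn.integrableOn_compact isCompact_Icc
    have hmarkov := mul_meas_ge_le_integral_of_nonneg
      (Filter.Eventually.of_forall hw0 : 0 ≤ᵐ[volume.restrict (Set.Icc 0 T)] w) hint (δ / 2)
    rw [integral_Icc_eq_integral_Ioc, ← intervalIntegral.integral_of_le hT.le,
      measureReal_restrict_apply (measurableSet_le measurable_const hw.measurable)] at hmarkov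
    have hcov : Set.Icc 0 T ⊆ G ∪ ({t | δ / 2 ≤ w t} ∩ Set.Icc 0 T) := by
      intro s hs
      rcases le_total (w s) (δ / 2) with h | h
      · exact Or.inl (hKG ⟨hs, h⟩)
      · exact Or.inr ⟨h, hs⟩
    have hfin : volume (G ∪ ({t | δ / 2 ≤ w t} ∩ Set.Icc 0 T)) ≠ ⊤ := by
      refine ((measure_mono (Set.union_subset hGI Set.inter_subset_right)).trans_lt ?_).ne
      exact measure_Icc_lt_top
    have hle := (measureReal_mono hcov hfin).trans (measureReal_union_le _ _)
    rw [Real.volume_real_Icc_of_le hT.le, sub_zero] at hle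
    rw [le_div_iff₀ hT]
    have h2 : volume.real ({t | δ / 2 ≤ w t} ∩ Set.Icc 0 T) ≤ 2 * B / δ * T := by
      have h3 := hmarkov.trans hB
      have e : 2 * B / δ * T = T * B / (δ / 2) := by field_simp
      rw [e, le_div_iff₀ (by positivity)]
      linarith
    linarith
  · rintro s ⟨I, ⟨t, ht, rfl⟩, hs⟩
    exact hr t (hF t ht).2 s hs.1

/-! ### Evolution of the initial state and thermalization -/

theorem evolve_initialState {N L : ℕ} [NeZero L] (hodd : Odd L) {θ : ℝ}
    (hnd : Nondegenerate L N θ) (t : ℝ) :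
    evolve L θ t (initialState L N) = ∑ κ : Config L N,
      (inner ℂ (slaterState κ) (initialState L N)
        * Complex.exp (-(Complex.I * (configEnergy θ κ * t : ℝ)))) • slaterState κ := by
  obtain ⟨b, hb⟩ := exists_slaterState_basis (N := N) hodd hnd
  have hmem : initialState L N ∈ sector L N := by
    rw [initialState]
    exact (prod_creation_vacuum (erdosTuranSite L N)) ▸ slater_mem_sector _
  have h0 : initialState L N
      = ∑ κ : Config L N, (inner ℂ (slaterState κ) (initialState L N)) • slaterState κ := by
    have h := congrArg (Submodule.subtype (sector L N)) (b.sum_repr' ⟨initialState L N, hmem⟩)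
    rw [map_sum] at h
    simp only [map_smul, Submodule.subtype_apply, Submodule.coe_inner, hb] at h
    exact h.symm
  have hlin : ∀ (s : Finset (Config L N)) (c : Config L N → ℂ),
      evolve L θ t (∑ κ ∈ s, c κ • slaterState κ)
        = ∑ κ ∈ s, c κ • evolve L θ t (slaterState κ) := by
    intro s c
    simp only [evolve, map_sum, map_smul]
  conv_lhs => rw [h0]
  rw [hlin]
  simp_rw [evolve_slaterState, smul_smul]

theorem sum_norm_sq_overlap {N L : ℕ} [NeZero L] (hN : N.Prime)
    (hL : 2 * erdosTuran N N - 1 ≤ L) (hodd : Odd L) {θ : ℝ} (hnd : Nondegenerate L N θ) :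
    ∑ κ : Config L N, ‖inner ℂ (slaterState κ) (initialState L N)‖ ^ 2 = 1 := by
  obtain ⟨b, hb⟩ := exists_slaterState_basis (N := N) hodd hnd
  have hmem : initialState L N ∈ sector L N := by
    rw [initialState]
    exact (prod_creation_vacuum (erdosTuranSite L N)) ▸ slater_mem_sector _
  have h := b.sum_sq_norm_inner_right ⟨initialState L N, hmem⟩
  simp only [Submodule.coe_inner, hb] at h
  rw [h, Submodule.coe_norm]
  simp [initialState_eq hN hL]

theorem norm_evolve_initialState {N L : ℕ} [NeZero L] (hN : N.Prime)
    (hL : 2 * erdosTuran N N - 1 ≤ L) (hodd : Odd L) {θ : ℝ} (hnd : Nondegenerate L N θ) (t : ℝ) :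
    ‖evolve L θ t (initialState L N)‖ = 1 := by
  have h := (orthonormal_slaterState (N := N) hodd hnd).inner_sum
    (fun κ => inner ℂ (slaterState κ) (initialState L N)
        * Complex.exp (-(Complex.I * (configEnergy θ κ * t : ℝ))))
    (fun κ => inner ℂ (slaterState κ) (initialState L N)
        * Complex.exp (-(Complex.I * (configEnergy θ κ * t : ℝ)))) Finset.univ
  rw [← evolve_initialState hodd hnd] at h
  have h1 : ∀ κ : Config L N,
      ‖Complex.exp (-(Complex.I * (configEnergy θ κ * t : ℝ)))‖ = 1 := by
    intro κ
    rw [← mul_neg, ← Complex.ofReal_neg, mul_comm, Complex.norm_exp_ofReal_mul_I]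
  simp_rw [Complex.conj_mul', norm_mul, h1, mul_one] at h
  have h2 : ‖evolve L θ t (initialState L N)‖ ^ 2 = 1 := by
    rw [← sum_norm_sq_overlap hN hL hodd hnd]
    have h3 := inner_self_eq_norm_sq (𝕜 := ℂ) (evolve L θ t (initialState L N))
    rw [h] at h3
    rw [← h3]
    simp [← Complex.ofReal_pow]
  exact (pow_eq_one_iff_of_nonneg (norm_nonneg _) two_ne_zero).mp h2

theorem evolve_initialState_mem_sector {N L : ℕ} [NeZero L] (hodd : Odd L) {θ : ℝ}
    (hnd : Nondegenerate L N θ) (t : ℝ) :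
    evolve L θ t (initialState L N) ∈ sector L N := by
  rw [evolve_initialState hodd hnd]
  exact Submodule.sum_mem _ fun κ _ => Submodule.smul_mem _ _ (slater_mem_sector _)

/-- The long-time average of the weight of the unbalanced configurations. -/
noncomputable def averageWeight (L N : ℕ) [NeZero L] (ε : ℝ) : ℝ :=
  ∑ κ : Config L N, ‖inner ℂ (slaterState κ) (initialState L N)‖ ^ 2
    * ∑ S ∈ unbalanced L N ε, ‖slaterState κ S.1‖ ^ 2

/-- Let M κ be the unbalanced weight of the eigenvector κ. Cauchy–Schwarz separates the overlaps
from M. Normalisation gives M κ ≤ 1, so ∑ M² ≤ ∑ M, and Bessel's inequality for each occupation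
state bounds ∑ M by the number of unbalanced configurations. -/
theorem averageWeight_sq_le {N L : ℕ} [NeZero L] (hodd : Odd L) {θ : ℝ}
    (hnd : Nondegenerate L N θ) (ε : ℝ) :
    averageWeight L N ε ^ 2 ≤ ((unbalanced L N ε).card : ℝ)
        * ∑ κ : Config L N, ‖inner ℂ (initialState L N) (slaterState κ)‖ ^ 4 := by
  have horth := orthonormal_slaterState (N := N) hodd hnd
  set M : Config L N → ℝ := fun κ => ∑ S ∈ unbalanced L N ε, ‖slaterState κ S.1‖ ^ 2 with hM
  have hM0 : ∀ κ, 0 ≤ M κ := fun κ => Finset.sum_nonneg fun _ _ => by positivity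
  have hM1 : ∀ κ, M κ ≤ 1 := by
    intro κ
    have h : ‖slaterState κ‖ ^ 2 = 1 := by rw [horth.1 κ, one_pow]
    rw [EuclideanSpace.norm_sq_eq] at h
    rw [← h]
    have h2 := Finset.sum_map (unbalanced L N ε) (Function.Embedding.subtype _)
      fun S => ‖slaterState κ S‖ ^ 2
    simp only [Function.Embedding.subtype_apply] at h2
    rw [hM]
    simp only
    rw [← h2]
    exact Finset.sum_le_sum_of_subset_of_nonneg (Finset.subset_univ _)
      fun _ _ _ => by positivity
  have hMsum : ∑ κ, M κ ^ 2 ≤ (unbalanced L N ε).card := by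
    calc ∑ κ, M κ ^ 2 ≤ ∑ κ, M κ :=
          Finset.sum_le_sum fun κ _ => by nlinarith [hM0 κ, hM1 κ]
      _ = ∑ S ∈ unbalanced L N ε, ∑ κ : Config L N, ‖slaterState κ S.1‖ ^ 2 := Finset.sum_comm
      _ ≤ ∑ S ∈ unbalanced L N ε, 1 := by
          refine Finset.sum_le_sum fun S _ => ?_
          have h := horth.sum_inner_products_le (x := EuclideanSpace.single S.1 (1 : ℂ))
            (s := Finset.univ)
          simpa [EuclideanSpace.inner_single_right] using h
      _ = (unbalanced L N ε).card := by simp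
  have hcs := Finset.sum_mul_sq_le_sq_mul_sq Finset.univ
    (fun κ : Config L N => ‖inner ℂ (slaterState κ) (initialState L N)‖ ^ 2) M
  refine hcs.trans ?_
  rw [mul_comm]
  refine mul_le_mul hMsum (Finset.sum_le_sum fun κ _ => ?_)
    (Finset.sum_nonneg fun _ _ => by positivity) (by positivity)
  rw [← pow_mul, norm_inner_symm]

theorem exists_integral_unbalanced_weight_le {N L : ℕ} [NeZero L] (hodd : Odd L) {θ : ℝ}
    (hnd : Nondegenerate L N θ)
    (ε : ℝ) :
    ∃ C, ∀ T, 0 < T →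
      ∫ t in (0 : ℝ)..T, ∑ S ∈ unbalanced L N ε, ‖evolve L θ t (initialState L N) S.1‖ ^ 2
        ≤ T * averageWeight L N ε + C := by
  have hcoord : ∀ (t : ℝ) (S : Finset (Fin L)), evolve L θ t (initialState L N) S
      = ∑ κ : Config L N, (inner ℂ (slaterState κ) (initialState L N) * slaterState κ S)
        * Complex.exp (-(Complex.I * (configEnergy θ κ * t : ℝ))) := by
    intro t S
    rw [evolve_initialState hodd hnd]
    simp only [WithLp.ofLp_sum, Finset.sum_apply, PiLp.smul_apply, smul_eq_mul]
    exact Finset.sum_congr rfl fun κ _ => by ring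
  have h := fun S : Config L N => exists_integral_norm_sq_trigSum_le
    (configEnergy_injective hodd hnd)
    (fun κ => inner ℂ (slaterState κ) (initialState L N) * slaterState κ S.1)
  choose C hC using h
  refine ⟨∑ S ∈ unbalanced L N ε, C S, fun T hT => ?_⟩
  simp_rw [hcoord]
  rw [intervalIntegral.integral_finsetSum
    fun S _ => (by fun_prop : Continuous _).intervalIntegrable _ _]
  refine (Finset.sum_le_sum fun S _ => hC S T hT).trans_eq ?_
  rw [Finset.sum_add_distrib, ← Finset.mul_sum, averageWeight, Finset.sum_comm]
  simp_rw [Finset.mul_sum, norm_mul, mul_pow]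

theorem continuous_unbalanced_weight (L N : ℕ) (θ ε : ℝ) (Φ : Fock L) :
    Continuous fun t => ∑ S ∈ unbalanced L N ε, ‖evolve L θ t Φ S.1‖ ^ 2 := by
  have h : Continuous fun t => evolve L θ t Φ := by
    have h1 : Continuous fun t : ℝ => (-(Complex.I * t)) • hamiltonian L θ := by fun_prop
    have : NormedAlgebra ℚ (Fock L →L[ℂ] Fock L) := NormedAlgebra.restrictScalars ℚ ℂ _
    exact ((NormedSpace.exp_continuous.comp h1).clm_apply continuous_const)
  refine continuous_finsetSum _ fun S _ => ?_
  fun_prop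

theorem thermalization {N L : ℕ} [NeZero L] {θ ε : ℝ} (hε : 0 < ε) (hNε : 384 / ε ^ 4 ≤ N)
    (hN : N.Prime) (hLp : L.Prime) (hL : 2 * erdosTuran N N - 1 ≤ L)
    (hnd : Nondegenerate L N θ) :
    ∃ (T : ℝ) (G : Set ℝ), 0 < T ∧ G ⊆ Set.Icc 0 T ∧ IsUnionOfIntervals G ∧
      1 - Real.exp (-(ε ^ 2 / 4) * N) ≤ volume.real G / T ∧
      ∀ t ∈ G, 1 - Real.exp (-(ε ^ 2 / 4) * N) <
        measurementProb (numberLeft L) (evolve L θ t (initialState L N))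
          {m : ℝ | |m / N - 1 / 2| ≤ ε} := by
  have hodd := odd_of_prime_of_le hN hLp hL
  set δ := Real.exp (-(ε ^ 2 / 4) * N) with hδ
  have hδ0 : 0 < δ := Real.exp_pos _
  have hN2 : (2 : ℝ) ≤ N := by exact_mod_cast hN.two_le
  -- Since (δ² / 4)² = e^{-ε²N} / 16, comparison with 6(N + 2)e^{-2ε²N} reduces the claim to 96(N +
  -- 2) ≤ e^{ε²N}.
  have hA : averageWeight L N ε ≤ δ ^ 2 / 4 := by
    refine abs_le_of_sq_le_sq' ?_ (by positivity) |>.2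
    refine (averageWeight_sq_le hodd hnd ε).trans
      ((card_unbalanced_mul_sum_overlap_le hN hLp hL hε).trans ?_)
    have e1 : (δ ^ 2 / 4) ^ 2 = Real.exp (-(2 * ε ^ 2 * N)) * Real.exp (ε ^ 2 * N) / 16 := by
      have : δ ^ 4 = Real.exp (-(2 * ε ^ 2 * N)) * Real.exp (ε ^ 2 * N) := by
        rw [hδ, ← Real.exp_nat_mul, ← Real.exp_add]
        congr 1
        push_cast
        ring
      rw [← this]
      ring
    have h1 := Real.quadratic_le_exp_of_nonneg (x := ε ^ 2 * N) (by positivity)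
    have h2 : 384 ≤ N * ε ^ 4 := by rwa [div_le_iff₀ (by positivity)] at hNε
    -- With x = ε²N, e^x ≥ x²/2 ≥ 192 N by ε⁴N ≥ 384, and 192 N ≥ 96(N + 2) because N ≥ 2.
    have h3 : 96 * ((N : ℝ) + 2) ≤ Real.exp (ε ^ 2 * N) := by
      have h4 : 0 ≤ ε ^ 2 * N := by positivity
      nlinarith [mul_le_mul_of_nonneg_left h2 (by positivity : (0 : ℝ) ≤ N)]
    rw [e1]
    have h5 := mul_le_mul_of_nonneg_left h3 (Real.exp_pos (-(2 * ε ^ 2 * N))).le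
    linarith
  obtain ⟨C, hC⟩ := exists_integral_unbalanced_weight_le hodd hnd ε
  -- Long enough for the constant C to cost at most another δ²/4 in the average; the summand 1 keeps
  -- T positive when C = 0. The average is then at most δ²/2, and Markov leaves a bad fraction of at
  -- most δ.
  set T := 4 * |C| / δ ^ 2 + 1 with hT
  have hT0 : 0 < T := by positivity
  have hB : T * averageWeight L N ε + C ≤ T * (δ ^ 2 / 2) := by
    have h1 : C ≤ T * (δ ^ 2 / 4) := by
      have : T * (δ ^ 2 / 4) = |C| + δ ^ 2 / 4 := by
        rw [hT]; field_simp
      rw [this]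
      linarith [le_abs_self C, sq_nonneg δ]
    have h2 := mul_le_mul_of_nonneg_left hA hT0.le
    linarith
  obtain ⟨G, hG1, hG2, hG3, hG4⟩ := exists_union_of_intervals_of_integral_le
    (continuous_unbalanced_weight L N θ ε (initialState L N))
    (fun t => Finset.sum_nonneg fun _ _ => by positivity) hδ0 hT0 ((hC T hT0).trans hB)
  refine ⟨T, G, hT0, hG1, hG2, ?_, fun t ht => ?_⟩
  · have e : 2 * (δ ^ 2 / 2) / δ = δ := by field_simp
    rwa [e] at hG3
  · have h1 := one_sub_le_measurementProb (evolve_initialState_mem_sector hodd hnd t)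
      (norm_evolve_initialState hN hL hodd hnd t) ε
    linarith [hG4 t ht]

end GolombChain

theorem mainTheorem6 :
    (∀ (N L : ℕ) [NeZero L] (θ : ℝ), N.Prime → L.Prime →
      2 * GolombChain.erdosTuran N N - 1 ≤ L → GolombChain.Nondegenerate L N θ →
      ∀ Ψ : OrthonormalBasis (Fin (Module.finrank ℂ (GolombChain.sector L N))) ℂ
          (GolombChain.sector L N),
        GolombChain.IsEnergyEigenbasis θ Ψ →
        (Module.finrank ℂ (GolombChain.sector L N) : ℝ) /
            GolombChain.effectiveDimension Ψ (GolombChain.initialState L N) ≤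
          ((N : ℝ) + 2 * Real.exp 1 - 3) / Real.exp 1) ∧
    (∀ ε : ℝ, 0 < ε → ∃ N₀ : ℕ, ∀ (N L : ℕ) [NeZero L] (θ : ℝ), N₀ ≤ N → N.Prime → L.Prime →
      2 * GolombChain.erdosTuran N N - 1 ≤ L → GolombChain.Nondegenerate L N θ →
      ∃ (T : ℝ) (G : Set ℝ), 0 < T ∧ G ⊆ Set.Icc 0 T ∧ GolombChain.IsUnionOfIntervals G ∧
        1 - Real.exp (-(ε ^ 2 / 4) * N) ≤ MeasureTheory.volume.real G / T ∧
        ∀ t ∈ G,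
          1 - Real.exp (-(ε ^ 2 / 4) * N) <
            GolombChain.measurementProb (GolombChain.numberLeft L)
              (GolombChain.evolve L θ t (GolombChain.initialState L N))
              {m : ℝ | |m / N - 1 / 2| ≤ ε}) := by
  refine ⟨fun N L _ θ hN hLp hL hnd Ψ hΨ =>
      GolombChain.effectiveDimension_bound hN hLp hL hnd Ψ hΨ,
    fun ε hε => ⟨⌈384 / ε ^ 4⌉₊, fun N L _ θ hN₀ hN hLp hL hnd => ?_⟩⟩
  exact GolombChain.thermalization hε (Nat.ceil_le.mp hN₀) hN hLp hL hnd
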